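/- Let $g\ge 2$ and let $X_0=\mathbb D/\Gamma_0$ be the standard closed Riemann surface of genus $g$: $D\subset\mathbb D$ is the regular hyperbolic $4g$-gon centred at $0$ with all angles $\pi/(2g)$, its consecutive sides are labelled $a_j,b_j,a_j^{-1},b_j^{-1}$ $(1\le j\le g)$, and $\Gamma_0$ is generated by the side pairings $\gamma_s$, where $\gamma_s(s)=D\cap\gamma_s(D)$ is the side corresponding to $s$. Let $\mathcal R$ be the net of all translates $\gamma(D)$, $\gamma\in\Gamma_0$, and let $V$ be the set of vertices of $\mathcal R$ that are not vertices of $D$ but are joined to a vertex of $D$ by an edge of $\mathcal R$. Let $W\subset S^1$ be the set of all endpoints at infinity of geodesics of $\mathcal R$ through points of $V$, and let $I_{1,0},\dots,I_{k,0}$ be the closed intervals into which $W$ cuts $S^1$. For a side $s$ let $J_s$ be the smaller arc of $S^1$ cut off by the geodesic through $s$. Let $f_0$ be any piecewise Möbius map such that, for each $j$, $f_0|I_{j,0}=\gamma_{s(j)}$ for a side $s(j)$ with $I_{j,0}\subset \operatorname{int}J_{s(j)}$ (for $f_0$ each $I_{j,0}$ carries its own branch $\gamma_{s(j)}$, also at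 its endpoints). Put $a_{ij}=1$ if $f_0(I_{i,0})\supset I_{j,0}$ and $a_{ij}=0$ otherwise, and $$\Sigma_A^*=\{w^*=\cdots j_n\cdots j_1j_0 \;:\; a_{j_{n+1}j_n}=1 \text{ for all } n\ge 0\}.$$ Let $X=\mathbb D/\Gamma_X$ be a closed hyperbolic Riemann surface with a marking, that is, a homeomorphism $h_X:X_0\to X$ (for example an orientation-preserving quasiconformal one), let $H$ be the homeomorphism of $\overline{\mathbb D}$ extending a lift of $h_X$, and let $\phi:\Gamma_0\to\Gamma_X$ be the isomorphism with $H\circ\gamma=\phi(\gamma)\circ H$. Put $I_j=H(I_{j,0})$ and $f_X=H\circ f_0\circ H^{-1}$ on $S^1$, so that $f_X|I_j=\phi(\gamma_{s(j)})|I_j$. If $a_{ij}=1$, let $g_{ij}$ be the inverse of the branch $f_X|I_i$, restricted to $I_j$. For an admissible word $w_n^*=j_n\cdots j_1j_0$ put $$I_{w_n^*}=g_{j_nj_{n-1}}\circ\cdots\circ g_{j_1j_0}(I_{j_0}),\qquad \sigma^*(w_n^*)=j_n\cdots j_1,$$ and write $|I|$ for the arc length of $I\subset S^1$. Then, as $n\to\infty$,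 the pre-scaling ratios $|I_{w_n^*}|/|I_{\sigma^*(w_n^*)}|$ along $w^*=\cdots j_n\cdots j_1j_0$ converge, uniformly in $w^*\in\Sigma_A^*$, to a function $$S_X:\Sigma_A^*\to(0,1],\qquad S_X(w^*)=\lim_{n\to\infty}\frac{|I_{w_n^*}|}{|I_{\sigma^*(w_n^*)}|}.$$ One has $S_X(w^*)=1$ if and only if $f_0(I_{j_1,0})=I_{j_0,0}$; for all other $w^*$, $S_X(w^*)\in(0,1)$. Moreover $S_X$ is Lipschitz: there are constants $C>0$ and $0<\mu<1$ such that $|S_X(w^*)-S_X(\tilde w^*)|\le C\mu^n$ whenever the first $n$ digits from the right of $w^*$ and $\tilde w^*$ agree. -/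

import Mathlib

open Filter MeasureTheory Set

noncomputable section

namespace ScalingFunction

/-! ### The closed unit disk and its Möbius group -/

/-- The closed unit disk; its interior `‖z‖ < 1` is the hyperbolic plane and `‖z‖ = 1` is the
circle at infinity `S¹`. -/
abbrev Disk : Type := Metric.closedBall (0 : ℂ) 1

/-- The circle at infinity. -/
def circle : Set Disk := {z | ‖(z : ℂ)‖ = 1}

/-- Arc length (angular Lebesgue measure) of a subset of the circle at infinity. -/
def arcLength (A : Set Disk) : ℝ :=
  (volume {θ : ℝ | θ ∈ Ioc (-Real.pi) Real.pi ∧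
    ∃ z ∈ A, (z : ℂ) = Complex.exp (θ * Complex.I)}).toReal

/-- `γ` is (the extension to the closed disk of) a conformal automorphism of the unit disk. -/
def IsMobius (γ : Disk ≃ₜ Disk) : Prop :=
  ∃ a b : ℂ, ‖b‖ < ‖a‖ ∧ ∀ z : Disk,
    (γ z : ℂ) = (a * z + b) / (starRingEnd ℂ b * z + starRingEnd ℂ a)

/-- `Γ` is a Fuchsian group uniformizing a closed hyperbolic Riemann surface: a group of conformal
automorphisms of the open disk acting properly discontinuously, freely and cocompactly. -/
structure IsSurfaceGroup (Γ : Subgroup (Disk ≃ₜ Disk)) : Prop where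
  mobius : ∀ γ ∈ Γ, IsMobius γ
  properlyDiscontinuous : ∀ ρ : ℝ, ρ < 1 →
    {γ | γ ∈ Γ ∧ ∃ z : Disk, ‖(z : ℂ)‖ ≤ ρ ∧ ‖(γ z : ℂ)‖ ≤ ρ}.Finite
  free : ∀ γ ∈ Γ, γ ≠ 1 → ∀ z : Disk, ‖(z : ℂ)‖ < 1 → γ z ≠ z
  cocompact : ∃ ρ : ℝ, ρ < 1 ∧ ∀ z : Disk, ‖(z : ℂ)‖ < 1 → ∃ γ ∈ Γ, ‖(γ z : ℂ)‖ ≤ ρ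

/-! ### The regular `4g`-gon and the group `Γ₀` of the standard surface of genus `g`

The regular hyperbolic `4g`-gon `D` centred at `0` with all angles `π / (2g)` has its vertices at
the points `vertexRadius g * exp (2πik / (4g))`. The geodesic through the `i`-th side (from vertex
`i` to vertex `i + 1`) is the part in the disk of the Euclidean circle with centre
`lineCenter g * sideDir g i`, orthogonal to the unit circle. -/

/-- Euclidean distance from `0` to the vertices of `D`. -/
def vertexRadius (g : ℕ) : ℝ := √(Real.cos (Real.pi / (2 * g)))

/-- Euclidean distance from `0` to the centres of the circles carrying the sides of `D`. -/
def lineCenter (g : ℕ) : ℝ := Real.cos (Real.pi / (4 * g)) / vertexRadius g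

/-- The unit vector pointing from `0` to the midpoint of the `i`-th side. -/
def sideDir (g : ℕ) (i : ℕ) : ℂ :=
  Complex.exp (((2 * i + 1) * Real.pi / (4 * g) : ℝ) * Complex.I)

lemma norm_sideDir (g i : ℕ) : ‖sideDir g i‖ = 1 := Complex.norm_exp_ofReal_mul_I _

lemma vertexRadius_nonneg (g : ℕ) : 0 ≤ vertexRadius g := Real.sqrt_nonneg _

lemma vertexRadius_le_one (g : ℕ) : vertexRadius g ≤ 1 := by
  unfold vertexRadius
  exact Real.sqrt_le_iff.mpr ⟨zero_le_one, by simpa using Real.cos_le_one _⟩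

lemma vertexRadius_pos {g : ℕ} (hg : 2 ≤ g) : 0 < vertexRadius g := by
  unfold vertexRadius
  apply Real.sqrt_pos.mpr
  have hg' : (2 : ℝ) ≤ g := by exact_mod_cast hg
  apply Real.cos_pos_of_mem_Ioo
  constructor
  · have : 0 < Real.pi / (2 * g) := by positivity
    linarith [Real.pi_pos]
  · apply div_lt_div_of_pos_left Real.pi_pos (by norm_num)
    linarith

lemma one_lt_lineCenter {g : ℕ} (hg : 2 ≤ g) : 1 < lineCenter g := by
  have hr := vertexRadius_pos hg
  have hg' : (2 : ℝ) ≤ g := by exact_mod_cast hg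
  have h0 : 0 < Real.pi / (4 * g) := by positivity
  have h1 : Real.pi / (4 * g) < Real.pi / 2 := by
    apply div_lt_div_of_pos_left Real.pi_pos (by norm_num)
    linarith
  have hc : 0 < Real.cos (Real.pi / (4 * g)) :=
    Real.cos_pos_of_mem_Ioo ⟨by linarith [Real.pi_pos], h1⟩
  have hs : 0 < Real.sin (Real.pi / (4 * g)) :=
    Real.sin_pos_of_pos_of_lt_pi h0 (by linarith [Real.pi_pos])
  rw [lineCenter, one_lt_div hr, vertexRadius, Real.sqrt_lt' hc]
  have h2 : Real.pi / (2 * (g : ℝ)) = 2 * (Real.pi / (4 * g)) := by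
    field_simp
    norm_num
  rw [h2, Real.cos_two_mul]
  nlinarith [Real.sin_sq_add_cos_sq (Real.pi / (4 * (g : ℝ)))]

/-- The vertices of `D`, in counterclockwise order. -/
def vertex (g : ℕ) (k : ℕ) : Disk :=
  ⟨vertexRadius g * Complex.exp ((2 * Real.pi * k / (4 * g) : ℝ) * Complex.I), by
    rw [mem_closedBall_zero_iff, norm_mul, Complex.norm_exp_ofReal_mul_I, mul_one,
      Complex.norm_real, Real.norm_of_nonneg (vertexRadius_nonneg g)]
    exact vertexRadius_le_one g⟩

/-- The (complete, closed) geodesic through the `i`-th side of `D`, with its ideal endpoints. -/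
def line (g : ℕ) (i : ℕ) : Set Disk :=
  {z | ‖(z : ℂ) - lineCenter g * sideDir g i‖ ^ 2 = lineCenter g ^ 2 - 1}

/-- The interior of the smaller arc `J_s` cut from the circle by the geodesic through the side
`s = i` of `D`. -/
def openArc (g : ℕ) (i : ℕ) : Set Disk :=
  {z | ‖(z : ℂ)‖ = 1 ∧ ‖(z : ℂ) - lineCenter g * sideDir g i‖ ^ 2 < lineCenter g ^ 2 - 1}

/-- The side corresponding to a side: consecutive sides are labelled
`a_j, b_j, a_j⁻¹, b_j⁻¹`, and `a_j` corresponds to `a_j⁻¹`, `b_j` to `b_j⁻¹`. -/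
def partner {g : ℕ} (i : Fin (4 * g)) : Fin (4 * g) :=
  ⟨if i.val % 4 < 2 then i.val + 2 else i.val - 2, by
    have := i.isLt
    split_ifs <;> omega⟩

lemma pairing_denom_ne {C : ℝ} (hC : 1 < C) {u z : ℂ} (hu : ‖u‖ = 1) (hz : ‖z‖ ≤ 1) :
    z - C * u ≠ 0 := by
  intro h
  have h1 : z = C * u := sub_eq_zero.mp h
  have h2 : ‖z‖ = C := by
    rw [h1, norm_mul, hu, mul_one, Complex.norm_real, Real.norm_of_nonneg (by linarith)]
  linarith

lemma pairing_norm_le {C : ℝ} (hC : 1 < C) {u v z : ℂ} (hu : ‖u‖ = 1) (hv : ‖v‖ = 1)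
    (hz : ‖z‖ ≤ 1) : ‖v * (C * z - u) / (z - C * u)‖ ≤ 1 := by
  have hne := pairing_denom_ne hC hu hz
  rw [norm_div, norm_mul, hv, one_mul, div_le_one (norm_pos_iff.mpr hne)]
  have hu2 : Complex.normSq u = 1 := by rw [Complex.normSq_eq_norm_sq, hu]; norm_num
  have hz2 : Complex.normSq z ≤ 1 := by
    rw [Complex.normSq_eq_norm_sq]
    nlinarith [norm_nonneg z]
  refine (sq_le_sq₀ (norm_nonneg _) (norm_nonneg _)).mp ?_
  rw [← Complex.normSq_eq_norm_sq, ← Complex.normSq_eq_norm_sq]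
  simp only [Complex.normSq_apply, Complex.sub_re, Complex.sub_im, Complex.mul_re,
    Complex.mul_im, Complex.ofReal_re, Complex.ofReal_im] at *
  have h1 : 0 ≤ (C ^ 2 - 1) * (1 - (z.re * z.re + z.im * z.im)) :=
    mul_nonneg (by nlinarith) (by linarith)
  have h2 : (C ^ 2 - 1) * (u.re * u.re + u.im * u.im) = (C ^ 2 - 1) * 1 := by rw [hu2]
  nlinarith

lemma pairing_leftInv {C : ℝ} (hC : 1 < C) {u v z : ℂ} (hu : ‖u‖ = 1) (hv : ‖v‖ = 1)
    (hz : ‖z‖ ≤ 1) :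
    u * (C * (v * (C * z - u) / (z - C * u)) - v) / (v * (C * z - u) / (z - C * u) - C * v)
      = z := by
  have hne := pairing_denom_ne hC hu hz
  have hne' := pairing_denom_ne hC hv (pairing_norm_le hC hu hv hz)
  rw [div_eq_iff hne']
  have h : v * (C * z - u) / (z - C * u) * (z - C * u) = v * (C * z - u) :=
    div_mul_cancel₀ _ hne
  linear_combination -h

/-- The conformal automorphism `z ↦ v (C z - u) / (z - C u)` (`|u| = |v| = 1 < C`): the inversion
in the circle orthogonal to the unit circle with centre `C u`, followed by the reflection that
exchanges the directions `u` and `v`. -/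
def pairing (C : ℝ) (hC : 1 < C) (u v : ℂ) (hu : ‖u‖ = 1) (hv : ‖v‖ = 1) : Disk ≃ₜ Disk where
  toFun z := ⟨v * (C * z - u) / (z - C * u),
    mem_closedBall_zero_iff.mpr (pairing_norm_le hC hu hv (mem_closedBall_zero_iff.mp z.2))⟩
  invFun z := ⟨u * (C * z - v) / (z - C * v),
    mem_closedBall_zero_iff.mpr (pairing_norm_le hC hv hu (mem_closedBall_zero_iff.mp z.2))⟩
  left_inv z := Subtype.ext (pairing_leftInv hC hu hv (mem_closedBall_zero_iff.mp z.2))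
  right_inv z := Subtype.ext (pairing_leftInv hC hv hu (mem_closedBall_zero_iff.mp z.2))
  continuous_toFun := by
    refine Continuous.subtype_mk (Continuous.div (by fun_prop) (by fun_prop) ?_) _
    exact fun z => pairing_denom_ne hC hu (mem_closedBall_zero_iff.mp z.2)
  continuous_invFun := by
    refine Continuous.subtype_mk (Continuous.div (by fun_prop) (by fun_prop) ?_) _
    exact fun z => pairing_denom_ne hC hv (mem_closedBall_zero_iff.mp z.2)

/-- The side pairing `γ_s` for the side `s = i`: the conformal automorphism with
`γ_s(s) = D ∩ γ_s(D) =` the side corresponding to `s`. Its isometric circle is the geodesic through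
`s`. (The condition `1 < lineCenter g` holds for all `g ≥ 2`, see `one_lt_lineCenter`.) -/
def gen (g : ℕ) (i : Fin (4 * g)) : Disk ≃ₜ Disk :=
  if hC : 1 < lineCenter g then
    pairing (lineCenter g) hC (sideDir g i) (sideDir g (partner i))
      (norm_sideDir g i) (norm_sideDir g (partner i))
  else 1

/-- The Fuchsian group `Γ₀` of the standard closed surface of genus `g`. -/
def Γ₀ (g : ℕ) : Subgroup (Disk ≃ₜ Disk) := Subgroup.closure (range (gen g))

lemma gen_mem (g : ℕ) (i : Fin (4 * g)) : gen g i ∈ Γ₀ g :=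
  Subgroup.subset_closure (mem_range_self i)

/-- The side pairing, as an element of `Γ₀`. -/
def gen₀ (g : ℕ) (i : Fin (4 * g)) : Γ₀ g := ⟨gen g i, gen_mem g i⟩

/-! ### The initial partition of the circle -/

/-- Two points are adjacent in the net of all translates `γ(D)`, `γ ∈ Γ₀`: they are the two
endpoints of an edge of the net. -/
def NetAdj (g : ℕ) (p q : Disk) : Prop :=
  ∃ γ ∈ Γ₀ g, ∃ i : Fin (4 * g),
    (p = γ (vertex g i.val) ∧ q = γ (vertex g (i.val + 1))) ∨
    (q = γ (vertex g i.val) ∧ p = γ (vertex g (i.val + 1)))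

/-- The vertices of the net which are not vertices of `D`, but are adjacent to one. -/
def neighbourVertices (g : ℕ) : Set Disk :=
  {p | (∀ i : Fin (4 * g), p ≠ vertex g i.val) ∧ ∃ i : Fin (4 * g), NetAdj g (vertex g i.val) p}

/-- `W_p`: the ideal endpoints of the geodesics of the net passing through `p`. -/
def idealEndpoints (g : ℕ) (p : Disk) : Set Disk :=
  {x | x ∈ circle ∧ ∃ γ ∈ Γ₀ g, ∃ i : Fin (4 * g), p ∈ γ '' line g i ∧ x ∈ γ '' line g i}

/-- The set `W` that cuts the circle. -/
def cutSet (g : ℕ) : Set Disk := ⋃ p ∈ neighbourVertices g, idealEndpoints g p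

/-- The intervals `I_{1,0}, …, I_{k,0}` into which `W` cuts the circle: the closures of the
connected components of the complement of `W`. They serve as the digits `1, …, k`. -/
def Interval (g : ℕ) : Type :=
  {I : Set Disk // ∃ x ∈ circle \ cutSet g,
    I = closure (connectedComponentIn (circle \ cutSet g) x)}

/-! ### The Markov map and the symbolic spaces -/

/-- A piecewise Möbius map `f₀` on the circle, equal on each interval `I` of the partition to the
side pairing `γ_s` of a side `s` such that `I` lies in the interior of `J_s`. Some intervals lie in
several `J_s`, so there are several such maps. -/
structure MarkovMap (g : ℕ) where
  side : Interval g → Fin (4 * g)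
  subset_openArc : ∀ I : Interval g, I.1 ⊆ openArc g (side I)

/-- The transition `I → J`, that is `f₀(I) ⊇ J` (the entry `a_{IJ}` of `A` is `1`). -/
def MarkovMap.Trans {g : ℕ} (f : MarkovMap g) (I J : Interval g) : Prop :=
  J.1 ⊆ gen g (f.side I) '' I.1

/-- The dual symbolic space `Σ_A^*` of all `⋯ j_n ⋯ j_1 j_0` with `j_{n+1} → j_n` for all `n`. -/
def MarkovMap.Dual {g : ℕ} (f : MarkovMap g) : Type :=
  {j : ℕ → Interval g // ∀ n, f.Trans (j (n + 1)) (j n)}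

/-- The finite word `j_n ⋯ j_1 j_0`, as a list that starts with `j_n`. -/
def word {α : Type*} (j : ℕ → α) : ℕ → List α
  | 0 => [j 0]
  | n + 1 => j (n + 1) :: word j n

/-- A real function on `Σ_A^*` is Lipschitz if there are `C > 0` and `0 < μ < 1` such that
`|S(w) - S(w')| ≤ C μ^n` whenever the first `n` digits from the right of `w`, `w'` agree. -/
def MarkovMap.IsLipschitz {g : ℕ} (f : MarkovMap g) (S : f.Dual → ℝ) : Prop :=
  ∃ C μ : ℝ, 0 < C ∧ 0 < μ ∧ μ < 1 ∧ ∀ (w w' : f.Dual) (n : ℕ),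
    (∀ m < n, w.1 m = w'.1 m) → |S w - S w'| ≤ C * μ ^ n

/-! ### Marked surfaces, nested Markov partitions and the pre-scaling function -/

/-- A closed Riemann surface `X = 𝔻 / Γ` marked by the standard surface `𝔻 / Γ₀`. The marking
`𝔻 / Γ₀ → X` is a homeomorphism (orientation-preserving quasiconformal ones are a special case); it
is given by a lift to the disk, extended to the closed disk, which conjugates the action of `Γ₀` to
that of `Γ` and so induces the isomorphism `φ`. The restriction of the lift to the circle is
the boundary correspondence. -/
structure MarkedSurface (g : ℕ) where
  Γ : Subgroup (Disk ≃ₜ Disk)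
  isSurfaceGroup : IsSurfaceGroup Γ
  φ : Γ₀ g ≃* Γ
  lift : Disk ≃ₜ Disk
  lift_mem_circle : ∀ z, lift z ∈ circle ↔ z ∈ circle
  equivariant : ∀ (γ : Γ₀ g) (z : Disk), lift (γ.1 z) = (φ γ).1 (lift z)

namespace MarkedSurface

variable {g : ℕ} (X : MarkedSurface g) (f : MarkovMap g)

/-- The interval `I_{j,X}` of the initial Markov partition for `X`. -/
def interval (I : Interval g) : Set Disk := X.lift '' I.1

/-- The Möbius map `φ(γ_s) ∈ Γ` with which the Markov map `f_X` coincides on `I_{j,X}`. -/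
def branch (I : Interval g) : Disk ≃ₜ Disk := (X.φ (gen₀ g (f.side I))).1

/-- The interval `I_w` of the nested Markov partitions for the word `w = i_0 i_1 ⋯ i_n`, namely
`g_{i_0 i_1} ⋯ g_{i_{n-1} i_n} (I_{i_n})`, where `g_{ij}` is the inverse of the branch of `f_X`
on `I_i`; the empty word gives the circle. -/
def cylinder : List (Interval g) → Set Disk
  | [] => circle
  | i :: w => X.interval i ∩ X.branch f i ⁻¹' cylinder w

/-- The pre-scaling function `|I_w| / |I_{σ^*(w)}|`; `σ^*` drops the last digit on the right. -/
def preScaling (w : List (Interval g)) : ℝ :=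
  arcLength (X.cylinder f w) / arcLength (X.cylinder f w.dropLast)

end MarkedSurface

end ScalingFunction

end

open ScalingFunction

/-!
The two intervals in a pre-scaling ratio are the images of fixed nested sets `K ⊆ I` under one
element of the Fuchsian group of `X`: the inverse branch `T_n` along `j_n ⋯ j_1`, where `I` is the
interval of `j_1` and `K` is the part of it which the Markov map sends to the interval of `j_0`.
Passing from `n` to `n + 1` applies one more of finitely many Möbius maps, and on a set of diameter
`d` such a map changes length ratios by at most a constant times `d`
(`HasPole.abs_ratio_image_sub_le`). So everything follows if the diameter of `T_n I` decays
exponentially (`MarkedSurface.exists_exponential_contraction`): the ratios then converge at a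
uniform exponential rate. The limit is positive because the distortion of `T_n` on `I` is bounded, and
applied to `I \ K` the same bound shows that the limit is `1` only if `K = I`.

For the standard surface the contraction is visible: each interval lies inside the isometric circle
of its side pairing, so the inverse branches contract by a definite factor, even on neighbourhoods
of fixed size. The marking is only a homeomorphism, and its uniform continuity yields that the
inverse branches for `X` map neighbourhoods of a fixed size `δ` to small sets, without any rate.
But a Möbius map of the circle that maps the `δ`-neighbourhood of a point to a set much smaller than
`δ²` is a contraction near this point (`HasPole.dist_le_of_small`). Therefore some number of steps
contracts by the factor `1 / 2`, which gives the rate. This also bounds the distortion: the point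
sent to `0`, which governs it, stays away from the interval (`HasPole.half_le_norm_sub`).

The intervals must be finitely many and must have positive length. Both follow from finiteness of
the cut set (`MarkedSurface.finite_cutSet`). The marking transports proper discontinuity from the
group of `X` to `Γ₀`, so it is enough that every point of the geodesic through a side is equivalent,
by an element mapping this geodesic to the geodesic through a side, to a point in a fixed compact
set. This holds because a product of `2g` side pairings is, up to symmetries of the polygon, a
half-turn about a vertex (`exists_vertexCoord_eq_neg`), and such half-turns move the points of the
geodesic beyond the vertex towards the centre.

Arc length is handled as one-dimensional Hausdorff measure for the chordal distance, in which a
Möbius map has an exact distortion formula.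
-/

namespace ScalingFunction

/-! ### Arc length as one-dimensional Hausdorff measure -/

/-- The point of the circle at infinity with argument `θ`. -/
noncomputable def circlePoint (θ : ℝ) : Disk :=
  ⟨Complex.exp (θ * Complex.I), by
    rw [mem_closedBall_zero_iff, Complex.norm_exp_ofReal_mul_I]⟩

lemma circlePoint_mem (θ : ℝ) : circlePoint θ ∈ circle := Complex.norm_exp_ofReal_mul_I θ

@[fun_prop]
lemma continuous_circlePoint : Continuous circlePoint :=
  Continuous.subtype_mk (by fun_prop) _

lemma exists_circlePoint_eq {z : Disk} (hz : z ∈ circle) :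
    ∃ θ ∈ Ioc (-Real.pi) Real.pi, circlePoint θ = z := by
  refine ⟨Complex.arg z, Complex.arg_mem_Ioc _, Subtype.ext ?_⟩
  have h := Complex.norm_mul_exp_arg_mul_I (z : ℂ)
  rw [show ‖(z : ℂ)‖ = 1 from hz] at h
  simpa [circlePoint] using h

lemma injOn_circlePoint : InjOn circlePoint (Ioc (-Real.pi) Real.pi) := by
  intro s hs t ht h
  have h' : Complex.exp (s * Complex.I) = Complex.exp (t * Complex.I) := congrArg Subtype.val h
  rw [← Complex.arg_exp_mul_I s |>.trans ((toIocMod_eq_self _).mpr (by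
      rwa [show -Real.pi + 2 * Real.pi = Real.pi by ring])), h',
    Complex.arg_exp_mul_I t |>.trans ((toIocMod_eq_self _).mpr (by
      rwa [show -Real.pi + 2 * Real.pi = Real.pi by ring]))]

lemma isClosed_circle : IsClosed circle :=
  isClosed_eq (by fun_prop) continuous_const

lemma dist_circlePoint (s t : ℝ) :
    dist (circlePoint s) (circlePoint t) = |2 * Real.sin ((s - t) / 2)| := by
  rw [Subtype.dist_eq, Complex.dist_eq]
  have h : Complex.exp (s * Complex.I) - Complex.exp (t * Complex.I)
      = Complex.exp (t * Complex.I) * (Complex.exp (Complex.I * ((s - t : ℝ) : ℂ)) - 1) := by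
    rw [mul_sub, ← Complex.exp_add]
    push_cast
    ring_nf
  change ‖Complex.exp (s * Complex.I) - Complex.exp (t * Complex.I)‖ = _
  rw [h, norm_mul, Complex.norm_exp_ofReal_mul_I, one_mul, Complex.norm_exp_I_mul_ofReal_sub_one,
    Real.norm_eq_abs]

lemma dist_circlePoint_le (s t : ℝ) : dist (circlePoint s) (circlePoint t) ≤ dist s t := by
  rw [dist_circlePoint, Real.dist_eq, abs_mul, abs_two]
  have h : |Real.sin ((s - t) / 2)| ≤ |(s - t) / 2| := Real.abs_sin_le_abs
  rw [abs_div, abs_two] at h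
  linarith

lemma le_dist_circlePoint {δ : ℝ} (hδ : δ ≤ 1) {s t : ℝ} (hst : |s - t| ≤ δ) :
    (1 - δ) * dist s t ≤ dist (circlePoint s) (circlePoint t) := by
  rw [Real.dist_eq, dist_circlePoint]
  wlog h : 0 ≤ s - t generalizing s t
  · have := this (s := t) (t := s) (by rwa [abs_sub_comm]) (by linarith)
    rwa [abs_sub_comm t s, show (t - s) / 2 = -((s - t) / 2) by ring, Real.sin_neg, mul_neg,
      abs_neg] at this
  rw [abs_of_nonneg h] at hst ⊢
  rcases h.eq_or_lt with h0 | h0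
  · simp [← h0]
  have h1 : (s - t) / 2 - ((s - t) / 2) ^ 3 / 6 < Real.sin ((s - t) / 2) :=
    Real.sin_gt_sub_cube (by linarith)
  refine le_trans ?_ (le_abs_self _)
  have h2 : (s - t) * (s - t) ≤ δ * 1 := mul_le_mul hst (by linarith) h (by linarith)
  nlinarith [mul_nonneg h (by linarith : (0 : ℝ) ≤ δ - (s - t) * (s - t)),
    mul_nonneg h (by linarith : (0 : ℝ) ≤ δ)]

lemma measurableSet_image_circlePoint {B : Set ℝ} (hB : MeasurableSet B)
    (hB' : B ⊆ Ioc (-Real.pi) Real.pi) : MeasurableSet (circlePoint '' B) :=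
  hB.image_of_continuousOn_injOn continuous_circlePoint.continuousOn (injOn_circlePoint.mono hB')

/-- Short arcs are almost as long as their chords, so cutting the circle into arcs of
length `δ` compares Lebesgue measure with Hausdorff measure up to the factor `1 - δ`. -/
lemma volume_le_hausdorffMeasure_image_circlePoint {B : Set ℝ} (hB : MeasurableSet B)
    (hB' : B ⊆ Ioc (-Real.pi) Real.pi) {δ : ℝ} (hδ : 0 < δ) (hδ' : δ < 1) :
    ENNReal.ofReal (1 - δ) * volume B ≤ μH[1] (circlePoint '' B) := by
  set P : ℤ → Set ℝ := fun k => B ∩ Ioc (0 + k • δ) (0 + (k + 1) • δ) with hP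
  have hPU : (⋃ k, P k) = B := by
    rw [hP, ← inter_iUnion, iUnion_Ioc_add_zsmul hδ, inter_univ]
  have hPd : Pairwise (Function.onFun Disjoint P) := fun i j hij =>
    (pairwise_disjoint_Ioc_add_zsmul (0 : ℝ) δ hij).mono inter_subset_right inter_subset_right
  have hPm : ∀ k, MeasurableSet (P k) := fun k => hB.inter measurableSet_Ioc
  have hpiece : ∀ k, ENNReal.ofReal (1 - δ) * volume (P k) ≤ μH[1] (circlePoint '' P k) := by
    intro k
    have hdist : ∀ s ∈ P k, ∀ t ∈ P k,
        (1 - δ) * dist s t ≤ dist (circlePoint s) (circlePoint t) := by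
      intro s hs t ht
      refine le_dist_circlePoint hδ'.le ?_
      have h1 := hs.2
      have h2 := ht.2
      simp only [zsmul_eq_mul, Int.cast_add, Int.cast_one, mem_Ioc] at h1 h2
      rw [abs_le]
      constructor <;> linarith [h1.1, h1.2, h2.1, h2.2]
    have hinv : LipschitzOnWith (Real.toNNReal (1 - δ)⁻¹)
        (Function.invFunOn circlePoint (P k)) (circlePoint '' P k) := by
      refine LipschitzOnWith.of_dist_le_mul ?_
      rintro _ ⟨s, hs, rfl⟩ _ ⟨t, ht, rfl⟩
      have hinj := injOn_circlePoint.mono (inter_subset_left.trans hB' : P k ⊆ _)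
      rw [hinj.leftInvOn_invFunOn hs, hinj.leftInvOn_invFunOn ht,
        Real.coe_toNNReal _ (inv_nonneg.mpr (by linarith))]
      have := hdist s hs t ht
      rw [inv_mul_eq_div, le_div_iff₀ (by linarith)]
      linarith
    have hle := hinv.hausdorffMeasure_image_le (d := 1) zero_le_one
    have hinj := injOn_circlePoint.mono (inter_subset_left.trans hB' : P k ⊆ _)
    rw [image_image, image_congr (fun x hx => hinj.leftInvOn_invFunOn hx), image_id',
      hausdorffMeasure_real, ENNReal.rpow_one] at hle
    calc ENNReal.ofReal (1 - δ) * volume (P k)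
        ≤ ENNReal.ofReal (1 - δ) * (ENNReal.ofReal (1 - δ)⁻¹ * μH[1] (circlePoint '' P k)) := by
          gcongr
          exact hle
      _ = μH[1] (circlePoint '' P k) := by
          rw [← mul_assoc, ← ENNReal.ofReal_mul (by linarith), mul_inv_cancel₀ (by linarith),
            ENNReal.ofReal_one, one_mul]
  calc ENNReal.ofReal (1 - δ) * volume B
      = ∑' k, ENNReal.ofReal (1 - δ) * volume (P k) := by
        rw [ENNReal.tsum_mul_left, ← measure_iUnion hPd hPm, hPU]
    _ ≤ ∑' k, μH[1] (circlePoint '' P k) := ENNReal.tsum_le_tsum hpiece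
    _ = μH[1] (circlePoint '' B) := by
        rw [← hPU, image_iUnion, measure_iUnion]
        · intro i j hij
          refine Set.disjoint_left.mpr ?_
          rintro _ ⟨s, hs, rfl⟩ ⟨t, ht, hst⟩
          rw [injOn_circlePoint (hB' ht.1) (hB' hs.1) hst] at ht
          exact Set.disjoint_left.mp (hPd hij) hs ht
        · exact fun k => measurableSet_image_circlePoint (hPm k) (inter_subset_left.trans hB')

lemma hausdorffMeasure_image_circlePoint {B : Set ℝ} (hB : MeasurableSet B)
    (hB' : B ⊆ Ioc (-Real.pi) Real.pi) : μH[1] (circlePoint '' B) = volume B := by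
  apply le_antisymm
  · have h : LipschitzOnWith 1 circlePoint B := LipschitzOnWith.of_dist_le_mul fun s _ t _ => by
      simpa using dist_circlePoint_le s t
    simpa [hausdorffMeasure_real] using h.hausdorffMeasure_image_le (d := 1) zero_le_one
  · have hlim : Tendsto (fun δ : ℝ => ENNReal.ofReal (1 - δ) * volume B) (nhdsWithin 0 (Ioi 0))
        (nhds (ENNReal.ofReal (1 - 0) * volume B)) := by
      refine ENNReal.Tendsto.mul_const ?_ (Or.inl (by simp))
      exact (ENNReal.continuous_ofReal.comp (by fun_prop : Continuous fun δ : ℝ => 1 - δ)).tendsto 0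
        |>.mono_left nhdsWithin_le_nhds
    simp only [sub_zero, ENNReal.ofReal_one, one_mul] at hlim
    refine le_of_tendsto hlim ?_
    filter_upwards [Ioo_mem_nhdsGT (zero_lt_one' ℝ)] with δ hδ
    exact volume_le_hausdorffMeasure_image_circlePoint hB hB' hδ.1 hδ.2

lemma setOf_angle_eq (A : Set Disk) :
    {θ : ℝ | θ ∈ Ioc (-Real.pi) Real.pi ∧ ∃ z ∈ A, (z : ℂ) = Complex.exp (θ * Complex.I)} =
      Ioc (-Real.pi) Real.pi ∩ circlePoint ⁻¹' A := by
  ext θ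
  refine and_congr_right fun _ => ⟨?_, fun h => ⟨_, h, rfl⟩⟩
  rintro ⟨z, hz, h⟩
  rwa [mem_preimage, show circlePoint θ = z from Subtype.ext h.symm]

lemma measurableSet_angle {A : Set Disk} (hA : MeasurableSet A) :
    MeasurableSet (Ioc (-Real.pi) Real.pi ∩ circlePoint ⁻¹' A) :=
  measurableSet_Ioc.inter (continuous_circlePoint.measurable hA)

lemma image_angle {A : Set Disk} (hA : A ⊆ circle) :
    circlePoint '' (Ioc (-Real.pi) Real.pi ∩ circlePoint ⁻¹' A) = A := by
  refine Subset.antisymm (by rintro _ ⟨θ, hθ, rfl⟩; exact hθ.2) fun z hz => ?_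
  obtain ⟨θ, hθ, rfl⟩ := exists_circlePoint_eq (hA hz)
  exact ⟨θ, ⟨hθ, hz⟩, rfl⟩

lemma hausdorffMeasure_eq_volume {A : Set Disk} (hA : MeasurableSet A) (hA' : A ⊆ circle) :
    μH[1] A = volume (Ioc (-Real.pi) Real.pi ∩ circlePoint ⁻¹' A) := by
  rw [← hausdorffMeasure_image_circlePoint (measurableSet_angle hA) inter_subset_left,
    image_angle hA']

lemma hausdorffMeasure_lt_top {A : Set Disk} (hA : MeasurableSet A) (hA' : A ⊆ circle) :
    μH[1] A < ⊤ := by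
  rw [hausdorffMeasure_eq_volume hA hA']
  exact (measure_mono inter_subset_left).trans_lt measure_Ioc_lt_top

lemma arcLength_eq_hausdorffMeasure {A : Set Disk} (hA : MeasurableSet A) (hA' : A ⊆ circle) :
    arcLength A = (μH[1] A).toReal := by
  rw [arcLength, setOf_angle_eq, hausdorffMeasure_eq_volume hA hA']

lemma arcLength_nonneg (A : Set Disk) : 0 ≤ arcLength A := ENNReal.toReal_nonneg

lemma arcLength_diff {A B : Set Disk} (hA : MeasurableSet A) (hB : MeasurableSet B)
    (hBA : B ⊆ A) (hA' : A ⊆ circle) : arcLength (A \ B) = arcLength A - arcLength B := by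
  rw [arcLength_eq_hausdorffMeasure (hA.diff hB) (sdiff_subset.trans hA'),
    arcLength_eq_hausdorffMeasure hA hA', arcLength_eq_hausdorffMeasure hB (hBA.trans hA'),
    measure_sdiff hBA hB.nullMeasurableSet (hausdorffMeasure_lt_top hB (hBA.trans hA')).ne,
    ENNReal.toReal_sub_of_le (measure_mono hBA) (hausdorffMeasure_lt_top hA hA').ne]

lemma arcLength_mono {A B : Set Disk} (hA : MeasurableSet A) (hB : MeasurableSet B)
    (hBA : B ⊆ A) (hA' : A ⊆ circle) : arcLength B ≤ arcLength A := by
  have := arcLength_diff hA hB hBA hA'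
  linarith [arcLength_nonneg (A \ B)]

/-- A set containing a nonempty relatively open subset of the circle has positive length. -/
lemma arcLength_pos {A U : Set Disk} (hA : MeasurableSet A) (hA' : A ⊆ circle)
    (hU : IsOpen U) (hUA : circle ∩ U ⊆ A) (hne : (circle ∩ U).Nonempty) : 0 < arcLength A := by
  rw [arcLength_eq_hausdorffMeasure hA hA']
  refine ENNReal.toReal_pos ?_ (hausdorffMeasure_lt_top hA hA').ne
  rw [hausdorffMeasure_eq_volume hA hA']
  obtain ⟨z, hz, hzU⟩ := hne
  obtain ⟨θ, hθ, rfl⟩ := exists_circlePoint_eq hz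
  have hopen : IsOpen (circlePoint ⁻¹' U) := hU.preimage continuous_circlePoint
  have hcl : θ ∈ closure (Ioo (-Real.pi) Real.pi) := by
    rw [closure_Ioo (by linarith [Real.pi_pos])]
    exact Ioc_subset_Icc_self hθ
  have hne := mem_closure_iff.mp hcl _ hopen hzU
  have hpos := (hopen.inter isOpen_Ioo).measure_pos volume hne
  refine (hpos.trans_le (measure_mono ?_)).ne'
  rintro t ⟨htU, ht⟩
  exact ⟨Ioo_subset_Ioc_self ht, hUA ⟨circlePoint_mem t, htU⟩⟩

lemma arcLength_image_le {A : Set Disk} (hA : MeasurableSet A) (hA' : A ⊆ circle)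
    (T : Disk ≃ₜ Disk) (hT : T '' A ⊆ circle) {L : ℝ} (hL : 0 ≤ L)
    (h : ∀ x ∈ A, ∀ y ∈ A, dist (T x) (T y) ≤ L * dist x y) :
    arcLength (T '' A) ≤ L * arcLength A := by
  have hTA : MeasurableSet (T '' A) := T.measurableEmbedding.measurableSet_image.mpr hA
  rw [arcLength_eq_hausdorffMeasure hTA hT, arcLength_eq_hausdorffMeasure hA hA']
  have hlip : LipschitzOnWith (Real.toNNReal L) T A := by
    refine LipschitzOnWith.of_dist_le_mul fun x hx y hy => ?_
    rw [Real.coe_toNNReal _ hL]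
    exact h x hx y hy
  have h1 := hlip.hausdorffMeasure_image_le (d := 1) zero_le_one
  rw [ENNReal.rpow_one] at h1
  refine (ENNReal.toReal_mono ?_ h1).trans_eq ?_
  · exact ENNReal.mul_ne_top ENNReal.coe_ne_top (hausdorffMeasure_lt_top hA hA').ne
  · rw [ENNReal.toReal_mul, ENNReal.coe_toReal, Real.coe_toNNReal _ hL]

/-! ### Möbius maps on the circle: chordal distortion and contraction -/

/-- The point `p` of the open disk controls the chordal distortion of `γ` on the circle as
`γ⁻¹(0)` does for a conformal automorphism `γ`: the derivative of `γ` at `z` has modulus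
`(1 - ‖p‖²) / ‖z - p‖²`. -/
structure HasPole (γ : Disk ≃ₜ Disk) (p : ℂ) : Prop where
  norm_lt : ‖p‖ < 1
  dist_mul : ∀ z ∈ circle, ∀ w ∈ circle,
    dist (γ z) (γ w) * (‖(z : ℂ) - p‖ * ‖(w : ℂ) - p‖) = (1 - ‖p‖ ^ 2) * dist z w

lemma mobius_denom_ne {a b z : ℂ} (hab : ‖b‖ < ‖a‖) (hz : ‖z‖ ≤ 1) :
    starRingEnd ℂ b * z + starRingEnd ℂ a ≠ 0 := by
  intro h
  have h1 : starRingEnd ℂ a = -(starRingEnd ℂ b * z) := by linear_combination h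
  have h2 : ‖a‖ = ‖b‖ * ‖z‖ := by
    rw [← RCLike.norm_conj a, h1, norm_neg, norm_mul, RCLike.norm_conj]
  nlinarith [norm_nonneg b]

lemma IsMobius.mem_circle {γ : Disk ≃ₜ Disk} (h : IsMobius γ) {z : Disk} (hz : z ∈ circle) :
    γ z ∈ circle := by
  obtain ⟨a, b, hab, hγ⟩ := h
  have hz1 : ‖(z : ℂ)‖ = 1 := hz
  have hne := mobius_denom_ne hab hz1.le
  change ‖(γ z : ℂ)‖ = 1
  have hzz : (z : ℂ) * starRingEnd ℂ (z : ℂ) = 1 := by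
    rw [Complex.mul_conj, Complex.normSq_eq_norm_sq, hz1]
    norm_num
  have hden : starRingEnd ℂ b * z + starRingEnd ℂ a = z * starRingEnd ℂ (a * z + b) := by
    simp only [map_add, map_mul]
    linear_combination -(starRingEnd ℂ a) * hzz
  rw [hγ, norm_div, div_eq_one_iff_eq (norm_ne_zero_iff.mpr hne), hden, norm_mul, hz1, one_mul,
    RCLike.norm_conj]

lemma IsMobius.exists_hasPole {γ : Disk ≃ₜ Disk} (h : IsMobius γ) : ∃ p, HasPole γ p := by
  obtain ⟨a, b, hab, hγ⟩ := h
  have ha : 0 < ‖a‖ := (norm_nonneg b).trans_lt hab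
  have ha0 : a ≠ 0 := norm_pos_iff.mp ha
  refine ⟨-b / a, ?_, ?_⟩
  · rwa [norm_div, norm_neg, div_lt_one ha]
  have hden : ∀ z ∈ circle,
      ‖starRingEnd ℂ b * z + starRingEnd ℂ a‖ = ‖a‖ * ‖(z : ℂ) - -b / a‖ := by
    intro z hz
    have hz1 : ‖(z : ℂ)‖ = 1 := hz
    have hzz : (z : ℂ) * starRingEnd ℂ (z : ℂ) = 1 := by
      rw [Complex.mul_conj, Complex.normSq_eq_norm_sq, hz1]
      norm_num
    have h1 : starRingEnd ℂ b * z + starRingEnd ℂ a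
        = z * starRingEnd ℂ (a * (z - -b / a)) := by
      rw [mul_sub, mul_div_cancel₀ _ ha0]
      simp only [map_sub, map_mul, map_neg]
      linear_combination -(starRingEnd ℂ a) * hzz
    rw [h1, norm_mul, hz1, one_mul, RCLike.norm_conj, norm_mul]
  intro z hz w hw
  have hnz := mobius_denom_ne hab (le_of_eq (show ‖(z : ℂ)‖ = 1 from hz))
  have hnw := mobius_denom_ne hab (le_of_eq (show ‖(w : ℂ)‖ = 1 from hw))
  have hdiff : (γ z : ℂ) - γ w = (a * starRingEnd ℂ a - b * starRingEnd ℂ b) * (z - w) /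
      ((starRingEnd ℂ b * z + starRingEnd ℂ a) * (starRingEnd ℂ b * w + starRingEnd ℂ a)) := by
    rw [hγ, hγ, div_sub_div _ _ hnz hnw]
    congr 1
    ring
  have hdet : ‖a * starRingEnd ℂ a - b * starRingEnd ℂ b‖ = ‖a‖ ^ 2 - ‖b‖ ^ 2 := by
    rw [Complex.mul_conj, Complex.mul_conj, Complex.normSq_eq_norm_sq, Complex.normSq_eq_norm_sq,
      ← Complex.ofReal_sub, Complex.norm_real, Real.norm_of_nonneg]
    nlinarith [norm_nonneg b]
  rw [Subtype.dist_eq, Subtype.dist_eq, Complex.dist_eq, Complex.dist_eq, hdiff, norm_div, norm_mul,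
    norm_mul (starRingEnd ℂ b * z + starRingEnd ℂ a), hdet, norm_div, norm_neg]
  have h1 := hden z hz
  have h2 := hden w hw
  have hp1 := norm_pos_iff.mpr hnz
  have hp2 := norm_pos_iff.mpr hnw
  rw [h1] at hp1 ⊢
  rw [h2] at hp2 ⊢
  have h3 := pos_of_mul_pos_right hp1 ha.le
  have h4 := pos_of_mul_pos_right hp2 ha.le
  generalize ‖(z : ℂ) - -b / a‖ = s at *
  generalize ‖(w : ℂ) - -b / a‖ = t at *
  field_simp

lemma exists_dist_eq_of_mem_circle {x : Disk} (hx : x ∈ circle) {t : ℝ} (ht : 0 ≤ t)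
    (ht' : t ≤ 2) : ∃ y ∈ circle, dist y x = t := by
  obtain ⟨θ, -, rfl⟩ := exists_circlePoint_eq hx
  refine ⟨circlePoint (θ + 2 * Real.arcsin (t / 2)), circlePoint_mem _, ?_⟩
  rw [dist_circlePoint, add_sub_cancel_left, mul_div_cancel_left₀ _ two_ne_zero,
    Real.sin_arcsin (by linarith) (by linarith), mul_div_cancel₀ _ two_ne_zero, abs_of_nonneg ht]

lemma one_sub_norm_le {p : ℂ} {z : Disk} (hz : z ∈ circle) : 1 - ‖p‖ ≤ ‖(z : ℂ) - p‖ := by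
  have := norm_sub_norm_le (z : ℂ) p
  rwa [show ‖(z : ℂ)‖ = 1 from hz] at this

namespace HasPole

variable {γ : Disk ≃ₜ Disk} {p : ℂ} (h : HasPole γ p)
include h

lemma one_sub_sq_pos : 0 < 1 - ‖p‖ ^ 2 := by nlinarith [norm_nonneg p, h.norm_lt]

lemma norm_sub_pos {z : Disk} (hz : z ∈ circle) : 0 < ‖(z : ℂ) - p‖ := by
  linarith [one_sub_norm_le (p := p) hz, h.norm_lt]

lemma norm_sub_le {z : Disk} (hz : z ∈ circle) : ‖(z : ℂ) - p‖ ≤ 2 := by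
  have := _root_.norm_sub_le (z : ℂ) p
  rw [show ‖(z : ℂ)‖ = 1 from hz] at this
  linarith [h.norm_lt]

lemma dist_le {z w : Disk} (hz : z ∈ circle) (hw : w ∈ circle) {m : ℝ} (hm : 0 < m)
    (h1 : m ≤ ‖(z : ℂ) - p‖) (h2 : m ≤ ‖(w : ℂ) - p‖) :
    dist (γ z) (γ w) ≤ (1 - ‖p‖ ^ 2) / m ^ 2 * dist z w := by
  have h0 := h.dist_mul z hz w hw
  rw [div_mul_eq_mul_div, le_div_iff₀ (by positivity), ← h0, sq]
  gcongr

lemma le_dist {z w : Disk} (hz : z ∈ circle) (hw : w ∈ circle) {M : ℝ}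
    (h1 : ‖(z : ℂ) - p‖ ≤ M) (h2 : ‖(w : ℂ) - p‖ ≤ M) :
    (1 - ‖p‖ ^ 2) * dist z w ≤ M ^ 2 * dist (γ z) (γ w) := by
  rw [← h.dist_mul z hz w hw, sq, mul_comm (M * M)]
  have h3 := h.norm_sub_pos hz
  have h4 : 0 < M := h3.trans_le h1
  gcongr

/-- If the image of the `δ`-neighbourhood of `x` is small, then the pole is not close to `x`:
seen from a pole close to `x`, the neighbourhood would be a large part of the circle. -/
lemma half_le_norm_sub {x : Disk} (hx : x ∈ circle) {δ η : ℝ} (hδ : δ ≤ 1) (hη : η ≤ 1 / 8)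
    (hsmall : ∀ y ∈ circle, dist y x ≤ δ → dist (γ y) (γ x) ≤ η) : δ / 2 ≤ ‖(x : ℂ) - p‖ := by
  by_contra! hlt
  set t := ‖(x : ℂ) - p‖ with ht
  have ht0 : 0 < t := h.norm_sub_pos hx
  have htp : 1 - ‖p‖ ≤ t := one_sub_norm_le hx
  have hp0 : 0 < ‖p‖ := by linarith
  -- the point of the circle nearest to the pole
  have hy : ‖p / ‖p‖‖ = 1 := by
    rw [norm_div, Complex.norm_real, norm_norm, div_self hp0.ne']
  obtain ⟨y, hyp⟩ : ∃ y : Disk, (y : ℂ) = p / ‖p‖ :=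
    ⟨⟨p / ‖p‖, mem_closedBall_zero_iff.mpr hy.le⟩, rfl⟩
  have hyc : y ∈ circle := by
    change ‖(y : ℂ)‖ = 1
    rw [hyp, hy]
  have hynear : ‖(y : ℂ) - p‖ = 1 - ‖p‖ := by
    have h1 : (y : ℂ) - p = (p / ‖p‖) * ((1 - ‖p‖ : ℝ) : ℂ) := by
      have : (‖p‖ : ℂ) ≠ 0 := by exact_mod_cast hp0.ne'
      rw [hyp]
      push_cast
      field_simp
    rw [h1, norm_mul, hy, one_mul, Complex.norm_real, Real.norm_of_nonneg]
    linarith [h.norm_lt]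
  have hyx : dist y x ≤ (1 - ‖p‖) + t := by
    rw [Subtype.dist_eq, ← hynear, ht, ← Complex.dist_eq, ← Complex.dist_eq, dist_comm (x : ℂ) p]
    exact dist_triangle _ _ _
  have hxy : t ≤ dist y x + (1 - ‖p‖) := by
    rw [Subtype.dist_eq, ← hynear, ht, ← Complex.dist_eq, ← Complex.dist_eq, dist_comm (y : ℂ) x]
    exact dist_triangle _ _ _
  have h1 := hsmall y hyc (by linarith)
  have h2 := h.dist_mul y hyc x hx
  rw [hynear] at h2
  have h3 : dist y x ≤ η * t := by
    have h4 : (1 - ‖p‖) * (dist (γ y) (γ x) * t) = (1 - ‖p‖) * ((1 + ‖p‖) * dist y x) := by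
      linear_combination h2
    have h5 := mul_left_cancel₀ (by linarith [h.norm_lt]) h4
    nlinarith [dist_nonneg (x := y) (y := x), mul_le_mul_of_nonneg_right h1 ht0.le]
  -- so the pole has distance about `t` from the circle, and a second point sees a large image
  obtain ⟨w, hw, hwx⟩ := exists_dist_eq_of_mem_circle hx ht0.le (by linarith)
  have h6 := hsmall w hw (by linarith)
  have h7 := h.dist_mul w hw x hx
  rw [hwx] at h7
  have h8 : ‖(w : ℂ) - p‖ ≤ 2 * t := by
    have := dist_triangle (w : ℂ) x p
    rw [← Subtype.dist_eq, hwx, Complex.dist_eq, Complex.dist_eq] at this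
    linarith
  have h9 : dist (γ w) (γ x) * ‖(w : ℂ) - p‖ = 1 - ‖p‖ ^ 2 :=
    mul_right_cancel₀ ht0.ne' (by linear_combination h7)
  have h10 : dist (γ w) (γ x) * ‖(w : ℂ) - p‖ ≤ 1 / 8 * (2 * t) := by
    gcongr
    exact h6.trans hη
  have h11 : η * t ≤ 1 / 8 * t := by gcongr
  nlinarith [h.norm_lt]

/-- A Möbius map with a small image of the `δ`-neighbourhood of `x` contracts near `x`. -/
lemma dist_le_of_small {x : Disk} (hx : x ∈ circle) {δ η : ℝ} (hδ0 : 0 < δ) (hδ : δ ≤ 1)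
    (hη : η ≤ 1 / 8)
    (hsmall : ∀ y ∈ circle, dist y x ≤ δ → dist (γ y) (γ x) ≤ η)
    {y : Disk} (hy : y ∈ circle) (hyx : dist y x ≤ δ / 4) :
    dist (γ y) (γ x) ≤ 16 * η / δ ^ 2 * dist y x := by
  have ht := h.half_le_norm_sub hx hδ hη hsmall
  set t := ‖(x : ℂ) - p‖ with ht'
  have ht0 : 0 < t := h.norm_sub_pos hx
  obtain ⟨w, hw, hwx⟩ := exists_dist_eq_of_mem_circle hx hδ0.le (by linarith)
  have h1 := h.dist_mul w hw x hx
  have h2 := hsmall w hw hwx.le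
  rw [hwx] at h1
  have h3 : (1 - ‖p‖ ^ 2) * δ ≤ η * (2 * t) := by
    rw [← h1]
    gcongr
    · exact dist_nonneg.trans h2
    · exact h.norm_sub_le hw
  have h4 : δ / 4 ≤ ‖(y : ℂ) - p‖ := by
    have := dist_triangle (x : ℂ) y p
    rw [dist_comm (x : ℂ) y, ← Subtype.dist_eq, Complex.dist_eq, Complex.dist_eq] at this
    linarith
  have h5 := h.dist_mul y hy x hx
  rw [div_mul_eq_mul_div, le_div_iff₀ (by positivity)]
  have h6 : dist (γ y) (γ x) * (δ / 4 * t) ≤ (1 - ‖p‖ ^ 2) * dist y x := by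
    rw [← h5]
    gcongr
  have h7 : (1 - ‖p‖ ^ 2) * δ * dist y x ≤ η * (2 * t) * dist y x := by gcongr
  have h8 : (dist (γ y) (γ x) * δ ^ 2) * t ≤ (8 * η * dist y x) * t := by
    nlinarith
  have h9 := le_of_mul_le_mul_right h8 ht0
  have : 0 ≤ η * dist y x := mul_nonneg (dist_nonneg.trans h2) dist_nonneg
  linarith

variable (hcirc : ∀ z ∈ circle, γ z ∈ circle)
include hcirc

lemma arcLength_image_le {A : Set Disk} (hA : MeasurableSet A) (hA' : A ⊆ circle) {m : ℝ}
    (hm : 0 < m) (h1 : ∀ z ∈ A, m ≤ ‖(z : ℂ) - p‖) :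
    arcLength (γ '' A) ≤ (1 - ‖p‖ ^ 2) / m ^ 2 * arcLength A := by
  have := h.one_sub_sq_pos
  refine ScalingFunction.arcLength_image_le hA hA' γ ?_ (by positivity) ?_
  · rintro _ ⟨z, hz, rfl⟩
    exact hcirc z (hA' hz)
  · exact fun z hz w hw => h.dist_le (hA' hz) (hA' hw) hm (h1 z hz) (h1 w hw)

lemma le_arcLength_image {A : Set Disk} (hA : MeasurableSet A) (hA' : A ⊆ circle) {M : ℝ}
    (hM : 0 < M) (h1 : ∀ z ∈ A, ‖(z : ℂ) - p‖ ≤ M) :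
    (1 - ‖p‖ ^ 2) / M ^ 2 * arcLength A ≤ arcLength (γ '' A) := by
  have hc := h.one_sub_sq_pos
  have hmeas : MeasurableSet (γ '' A) := γ.measurableEmbedding.measurableSet_image.mpr hA
  have hback : γ.symm '' (γ '' A) = A := by rw [image_image]; simp
  have key := ScalingFunction.arcLength_image_le hmeas
    (by rintro _ ⟨z, hz, rfl⟩; exact hcirc z (hA' hz)) γ.symm (by rwa [hback])
    (L := M ^ 2 / (1 - ‖p‖ ^ 2)) (by positivity) (by
      rintro _ ⟨z, hz, rfl⟩ _ ⟨w, hw, rfl⟩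
      have := h.le_dist (hA' hz) (hA' hw) (h1 z hz) (h1 w hw)
      rw [γ.symm_apply_apply, γ.symm_apply_apply, div_mul_eq_mul_div, le_div_iff₀ hc]
      linarith)
  rw [hback, div_mul_eq_mul_div, le_div_iff₀ hc] at key
  rw [div_mul_eq_mul_div, div_le_iff₀ (by positivity)]
  linarith

lemma arcLength_image_pos {A : Set Disk} (hA : MeasurableSet A) (hA' : A ⊆ circle)
    (hpos : 0 < arcLength A) : 0 < arcLength (γ '' A) := by
  have hc := h.one_sub_sq_pos
  refine lt_of_lt_of_le (by positivity)
    (h.le_arcLength_image hcirc hA hA' two_pos fun z hz => h.norm_sub_le (hA' hz))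

lemma le_ratio_image {I K : Set Disk} (hI : MeasurableSet I) (hI' : I ⊆ circle)
    (hK : MeasurableSet K) (hKI : K ⊆ I) (hpos : 0 < arcLength I) {m M : ℝ} (hm : 0 < m)
    (hM : 0 < M) (h1 : ∀ z ∈ I, m ≤ ‖(z : ℂ) - p‖) (h2 : ∀ z ∈ I, ‖(z : ℂ) - p‖ ≤ M) :
    (m / M) ^ 2 * (arcLength K / arcLength I) ≤ arcLength (γ '' K) / arcLength (γ '' I) := by
  have hc := h.one_sub_sq_pos
  have h3 := h.arcLength_image_le hcirc hI hI' hm h1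
  have h4 := h.le_arcLength_image hcirc hK (hKI.trans hI') hM fun z hz => h2 z (hKI hz)
  have h5 := h.arcLength_image_pos hcirc hI hI' hpos
  have h6 := arcLength_nonneg K
  calc (m / M) ^ 2 * (arcLength K / arcLength I)
      = ((1 - ‖p‖ ^ 2) / M ^ 2 * arcLength K) / ((1 - ‖p‖ ^ 2) / m ^ 2 * arcLength I) := by
        field_simp
    _ ≤ arcLength (γ '' K) / arcLength (γ '' I) := by
        have := arcLength_nonneg (γ '' K)
        gcongr

lemma ratio_image_le {I K : Set Disk} (hI : MeasurableSet I) (hI' : I ⊆ circle)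
    (hK : MeasurableSet K) (hKI : K ⊆ I) (hpos : 0 < arcLength I) {m M : ℝ} (hm : 0 < m)
    (hM : 0 < M) (h1 : ∀ z ∈ I, m ≤ ‖(z : ℂ) - p‖) (h2 : ∀ z ∈ I, ‖(z : ℂ) - p‖ ≤ M) :
    arcLength (γ '' K) / arcLength (γ '' I) ≤ (M / m) ^ 2 * (arcLength K / arcLength I) := by
  have hc := h.one_sub_sq_pos
  have h3 := h.arcLength_image_le hcirc hK (hKI.trans hI') hm fun z hz => h1 z (hKI hz)
  have h4 := h.le_arcLength_image hcirc hI hI' hM h2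
  have h6 := arcLength_nonneg K
  calc arcLength (γ '' K) / arcLength (γ '' I)
      ≤ ((1 - ‖p‖ ^ 2) / m ^ 2 * arcLength K) / ((1 - ‖p‖ ^ 2) / M ^ 2 * arcLength I) := by gcongr
    _ = (M / m) ^ 2 * (arcLength K / arcLength I) := by field_simp

/-- On a set of small diameter a Möbius map almost preserves ratios of lengths. -/
lemma abs_ratio_image_sub_le {I K : Set Disk} (hI : IsCompact I) (hI' : I ⊆ circle)
    (hK : MeasurableSet K) (hKI : K ⊆ I) (hpos : 0 < arcLength I) {d ρ : ℝ}
    (hd : ∀ z ∈ I, ∀ w ∈ I, dist z w ≤ d) (hρ : ρ < 1) (hp : ‖p‖ ≤ ρ) :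
    |arcLength (γ '' K) / arcLength (γ '' I) - arcLength K / arcLength I|
      ≤ 4 / (1 - ρ) ^ 2 * d := by
  have hne : I.Nonempty := by
    by_contra hne
    rw [not_nonempty_iff_eq_empty] at hne
    simp [hne, arcLength] at hpos
  have hcont : ContinuousOn (fun z : Disk => ‖(z : ℂ) - p‖) I := by fun_prop
  obtain ⟨z, hz, hzmin⟩ := hI.exists_isMinOn hne hcont
  obtain ⟨w, hw, hwmax⟩ := hI.exists_isMaxOn hne hcont
  set m := ‖(z : ℂ) - p‖ with hm
  set M := ‖(w : ℂ) - p‖ with hM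
  have hmin : ∀ x ∈ I, m ≤ ‖(x : ℂ) - p‖ := fun x hx => hzmin hx
  have hmax : ∀ x ∈ I, ‖(x : ℂ) - p‖ ≤ M := fun x hx => hwmax hx
  have hm0 : 1 - ρ ≤ m := by linarith [one_sub_norm_le (p := p) (hI' hz)]
  have hM2 : M ≤ 2 := h.norm_sub_le (hI' hw)
  have hmM : m ≤ M := hmin w hw
  have hdiff : M - m ≤ d := by
    refine le_trans ?_ (hd w hw z hz)
    rw [Subtype.dist_eq, Complex.dist_eq, hM, hm]
    simpa using norm_sub_norm_le ((w : ℂ) - p) ((z : ℂ) - p)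
  have hmpos : 0 < m := by linarith
  have hMpos : 0 < M := by linarith
  have hb1 := h.le_ratio_image hcirc hI.measurableSet hI' hK hKI hpos hmpos hMpos hmin hmax
  have hb2 := h.ratio_image_le hcirc hI.measurableSet hI' hK hKI hpos hmpos hMpos hmin hmax
  set r := arcLength K / arcLength I with hr
  have hr0 : 0 ≤ r := div_nonneg (arcLength_nonneg _) (arcLength_nonneg _)
  have hr1 : r ≤ 1 := by
    rw [hr, div_le_one hpos]
    exact arcLength_mono hI.measurableSet hK hKI hI'
  have hbound : (M / m) ^ 2 - 1 ≤ 4 / (1 - ρ) ^ 2 * d := by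
    have h1 : (M / m) ^ 2 - 1 = (M - m) * (M + m) / m ^ 2 := by field_simp; ring
    have hd0 : 0 ≤ d := by linarith
    rw [h1, div_mul_eq_mul_div]
    have h1ρ : 0 < 1 - ρ := by linarith
    gcongr ?_ / ?_ ^ 2
    nlinarith
  have hone : 1 ≤ (M / m) ^ 2 := by
    rw [one_le_sq_iff₀ (by positivity), one_le_div hmpos]
    exact hmM
  -- `1 - x⁻¹ ≤ x - 1` for `x = (M / m)²` reduces the lower bound to the upper one
  have hinv : 1 - (m / M) ^ 2 ≤ (M / m) ^ 2 - 1 := by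
    have h1 : (m / M) ^ 2 = ((M / m) ^ 2)⁻¹ := by rw [← inv_pow, inv_div]
    rw [h1]
    have h2 := inv_mul_cancel₀ (by linarith : (M / m) ^ 2 ≠ 0)
    have h3 : ((M / m) ^ 2)⁻¹ ≤ 1 := inv_le_one_of_one_le₀ hone
    nlinarith
  have hle1 : (m / M) ^ 2 ≤ 1 := by
    rw [sq_le_one_iff₀ (by positivity), div_le_one hMpos]
    exact hmM
  rw [abs_le]
  constructor <;> nlinarith

end HasPole

/-! ### Half-turns about the vertices of the polygon -/

section Polygon

variable {g : ℕ}

lemma lineCenter_mul_vertexRadius (hg : 2 ≤ g) :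
    lineCenter g * vertexRadius g = Real.cos (Real.pi / (4 * g)) :=
  div_mul_cancel₀ _ (vertexRadius_pos hg).ne'

lemma one_add_vertexRadius_sq (hg : 2 ≤ g) :
    1 + vertexRadius g ^ 2 = 2 * Real.cos (Real.pi / (4 * g)) ^ 2 := by
  have hpos : 0 ≤ Real.cos (Real.pi / (2 * g)) := by
    by_contra! h
    exact (vertexRadius_pos hg).ne' (Real.sqrt_eq_zero_of_nonpos h.le)
  have hg0 : (g : ℝ) ≠ 0 := by
    have : g ≠ 0 := by omega
    exact_mod_cast this
  rw [vertexRadius, Real.sq_sqrt hpos,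
    show Real.pi / (2 * (g : ℝ)) = 2 * (Real.pi / (4 * g)) by field_simp; norm_num,
    Real.cos_two_mul]
  ring

lemma sin_side_pos (hg : 2 ≤ g) : 0 < Real.sin (Real.pi / (4 * g)) := by
  have hg' : (2 : ℝ) ≤ g := by exact_mod_cast hg
  apply Real.sin_pos_of_pos_of_lt_pi
  · positivity
  · rw [div_lt_iff₀ (by positivity)]
    nlinarith [Real.pi_pos]

lemma cos_side_pos (hg : 2 ≤ g) : 0 < Real.cos (Real.pi / (4 * g)) := by
  rw [← lineCenter_mul_vertexRadius hg]
  exact mul_pos (zero_lt_one.trans (one_lt_lineCenter hg)) (vertexRadius_pos hg)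

lemma vertexRadius_lt_one (hg : 2 ≤ g) : vertexRadius g < 1 := by
  have h1 := one_add_vertexRadius_sq hg
  have h2 := sin_side_pos hg
  have h3 := Real.sin_sq_add_cos_sq (Real.pi / (4 * (g : ℝ)))
  nlinarith [vertexRadius_nonneg g]

lemma norm_vertex (g k : ℕ) : ‖(vertex g k : ℂ)‖ = vertexRadius g := by
  change ‖(vertexRadius g : ℂ) * Complex.exp _‖ = _
  rw [norm_mul, Complex.norm_exp_ofReal_mul_I, mul_one, Complex.norm_real,
    Real.norm_of_nonneg (vertexRadius_nonneg g)]

/-- The rotation by the angle `2π / (4g)`, which permutes the sides of the polygon cyclically. -/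
noncomputable def rot (g : ℕ) : ℂ := Complex.exp ((2 * Real.pi / (4 * g) : ℝ) * Complex.I)

lemma norm_rot (g : ℕ) : ‖rot g‖ = 1 := Complex.norm_exp_ofReal_mul_I _

lemma rot_ne_zero (g : ℕ) : rot g ≠ 0 := Complex.exp_ne_zero _

lemma sideDir_ne_zero (g i : ℕ) : sideDir g i ≠ 0 := Complex.exp_ne_zero _

lemma sideDir_eq (g k : ℕ) : sideDir g k = sideDir g 0 * rot g ^ k := by
  rw [sideDir, sideDir, rot, ← Complex.exp_nat_mul, ← Complex.exp_add]
  congr 1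
  push_cast
  ring

lemma rot_eq (g : ℕ) : rot g = sideDir g 0 ^ 2 := by
  rw [sideDir, rot, ← Complex.exp_nat_mul]
  congr 1
  push_cast
  ring

lemma rot_pow_half (hg : 2 ≤ g) : rot g ^ (2 * g) = -1 := by
  have hg0 : (g : ℂ) ≠ 0 := by
    have : g ≠ 0 := by omega
    exact_mod_cast this
  rw [rot, ← Complex.exp_nat_mul, ← Complex.exp_pi_mul_I]
  congr 1
  push_cast
  field_simp
  ring

lemma rot_pow_full (hg : 2 ≤ g) : rot g ^ (4 * g) = 1 := by
  rw [show 4 * g = 2 * g * 2 by ring, pow_mul, rot_pow_half hg]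
  norm_num

lemma sideDir_zero (g : ℕ) : sideDir g 0 =
    Real.cos (Real.pi / (4 * g)) + Real.sin (Real.pi / (4 * g)) * Complex.I := by
  rw [sideDir, Complex.exp_mul_I]
  push_cast
  ring_nf

lemma coe_gen (hg : 2 ≤ g) (i : Fin (4 * g)) (z : Disk) : (gen g i z : ℂ) =
    sideDir g (partner i) * (lineCenter g * z - sideDir g i) /
      (z - lineCenter g * sideDir g i) := by
  rw [gen, dif_pos (one_lt_lineCenter hg)]
  rfl

lemma norm_div_rot_sub {z : ℂ} {k : ℕ} {C : ℝ} :
    ‖z / rot g ^ k - C * sideDir g 0‖ = ‖z - C * sideDir g k‖ := by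
  have h : z / rot g ^ k - C * sideDir g 0 = (z - C * sideDir g k) / rot g ^ k := by
    have := rot_ne_zero g
    rw [sideDir_eq g k]
    field_simp
  rw [h, norm_div, norm_pow, norm_rot, one_pow, div_one]

/-- `(z - v) / (1 - v z)`: the coordinate of the disk that is centred at the vertex `v` of the
polygon on the positive real axis. -/
noncomputable def vertexCoord (g : ℕ) (z : ℂ) : ℂ := (z - vertexRadius g) / (1 - vertexRadius g * z)

lemma vertexCoord_denom_ne (hg : 2 ≤ g) {z : ℂ} (hz : ‖z‖ ≤ 1) : 1 - vertexRadius g * z ≠ 0 := by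
  intro h
  have h1 : (1 : ℂ) = vertexRadius g * z := by linear_combination h
  have h2 := congrArg norm h1
  rw [norm_one, norm_mul, Complex.norm_real, Real.norm_of_nonneg (vertexRadius_nonneg g)] at h2
  nlinarith [vertexRadius_lt_one hg, vertexRadius_nonneg g, norm_nonneg z]

/-- A side pairing turns the polygon about a vertex by the angle of the polygon there: up to
rotations about `0`, it is multiplication by `rot g` in the coordinate centred at the vertex. -/
lemma vertexCoord_gen (hg : 2 ≤ g) (i : Fin (4 * g)) (z : Disk) :
    vertexCoord g ((gen g i z : ℂ) / rot g ^ ((partner i : ℕ) + 1)) =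
      rot g * vertexCoord g ((z : ℂ) / rot g ^ (i : ℕ)) := by
  have hz1 : ‖(z : ℂ)‖ ≤ 1 := mem_closedBall_zero_iff.mp z.2
  have hrot := rot_ne_zero g
  have hw1 : ‖(z : ℂ) / rot g ^ (i : ℕ)‖ ≤ 1 := by
    rwa [norm_div, norm_pow, norm_rot, one_pow, div_one]
  have hgen1 : ‖(gen g i z : ℂ) / rot g ^ ((partner i : ℕ) + 1)‖ ≤ 1 := by
    rw [norm_div, norm_pow, norm_rot, one_pow, div_one]
    exact mem_closedBall_zero_iff.mp (gen g i z).2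
  obtain ⟨w, hw⟩ : ∃ w, w = (z : ℂ) / rot g ^ (i : ℕ) := ⟨_, rfl⟩
  have hzw : (z : ℂ) = rot g ^ (i : ℕ) * w := by rw [hw]; field_simp
  rw [← hw] at hw1 ⊢
  set u := sideDir g 0 with hu
  have hu0 : u ≠ 0 := sideDir_ne_zero g 0
  have hCu : w - lineCenter g * u ≠ 0 :=
    pairing_denom_ne (one_lt_lineCenter hg) (norm_sideDir g 0) hw1
  have hval : (gen g i z : ℂ) / rot g ^ ((partner i : ℕ) + 1) =
      (lineCenter g * w - u) / (u * (w - lineCenter g * u)) := by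
    have h1 : rot g ^ (i : ℕ) * w - lineCenter g * (u * rot g ^ (i : ℕ)) =
      rot g ^ (i : ℕ) * (w - lineCenter g * u) := by ring
    rw [coe_gen hg, sideDir_eq g i, sideDir_eq g (partner i), hzw, ← hu, h1, pow_succ, rot_eq,
      ← hu]
    field_simp
  have hd1 := vertexCoord_denom_ne hg hgen1
  have hd2 := vertexCoord_denom_ne hg hw1
  rw [hval] at hd1 ⊢
  have hCv : (lineCenter g * vertexRadius g : ℂ) = Real.cos (Real.pi / (4 * g)) := by
    exact_mod_cast lineCenter_mul_vertexRadius hg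
  have hv2 : (1 + vertexRadius g ^ 2 : ℂ) = 2 * Real.cos (Real.pi / (4 * g)) ^ 2 := by
    exact_mod_cast one_add_vertexRadius_sq hg
  -- `u + u⁻¹ = 2 cos (π / 4g)`
  have hquad : u ^ 2 - 2 * Real.cos (Real.pi / (4 * g)) * u + 1 = 0 := by
    rw [hu, sideDir_zero]
    have hcs : (Real.sin (Real.pi / (4 * g)) : ℂ) ^ 2 + Real.cos (Real.pi / (4 * g)) ^ 2 = 1 := by
      exact_mod_cast Real.sin_sq_add_cos_sq _
    linear_combination (Real.sin (Real.pi / (4 * g)) ^ 2 : ℂ) * Complex.I_sq - hcs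
  rw [vertexCoord, vertexCoord, rot_eq, ← hu, ← mul_div_assoc (u ^ 2), div_eq_div_iff hd1 hd2]
  generalize (vertexRadius g : ℂ) = v at *
  generalize (lineCenter g : ℂ) = C at *
  generalize (Real.cos (Real.pi / (4 * g)) : ℂ) = c at *
  field_simp
  linear_combination (w ^ 2 * (-u - c) + w * C * (u ^ 2 + 2 * c * u + 1) + u * (-c * u - 1)) * hquad
    + (w ^ 2 * u - 2 * C * u ^ 2 * w + u ^ 3) * hv2 + (w ^ 2 * (u ^ 2 - 1) + u ^ 2 - u ^ 4) * hCv

/-- Products of `m` side pairings turn about a vertex by `m` times the angle of the polygon. -/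
lemma exists_vertexCoord_eq_pow_mul (hg : 2 ≤ g) (m : ℕ) (i : Fin (4 * g)) :
    ∃ T ∈ Γ₀ g, ∃ k : Fin (4 * g), ∀ z : Disk,
      vertexCoord g ((T z : ℂ) / rot g ^ (k : ℕ)) =
        rot g ^ m * vertexCoord g ((z : ℂ) / rot g ^ (i : ℕ)) := by
  induction m with
  | zero => exact ⟨1, one_mem _, i, fun z => by simp⟩
  | succ m ih =>
    obtain ⟨T, hT, k, hTk⟩ := ih
    have hpos : 0 < 4 * g := by omega
    refine ⟨gen g k * T, mul_mem (gen_mem g k) hT,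
      ⟨((partner k : ℕ) + 1) % (4 * g), Nat.mod_lt _ hpos⟩, fun z => ?_⟩
    have hmod : rot g ^ (((partner k : ℕ) + 1) % (4 * g)) = rot g ^ ((partner k : ℕ) + 1) :=
      (pow_eq_pow_mod _ (rot_pow_full hg)).symm
    change vertexCoord g ((gen g k (T z) : ℂ) / rot g ^ (((partner k : ℕ) + 1) % (4 * g))) = _
    rw [hmod, vertexCoord_gen hg, hTk, pow_succ]
    ring

/-- The group `Γ₀` contains the half-turns about the vertices, up to symmetries of the polygon. -/
lemma exists_vertexCoord_eq_neg (hg : 2 ≤ g) (i : Fin (4 * g)) :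
    ∃ T ∈ Γ₀ g, ∃ k : Fin (4 * g), ∀ z : Disk,
      vertexCoord g ((T z : ℂ) / rot g ^ (k : ℕ)) =
        -vertexCoord g ((z : ℂ) / rot g ^ (i : ℕ)) := by
  obtain ⟨T, hT, k, h⟩ := exists_vertexCoord_eq_pow_mul hg (2 * g) i
  exact ⟨T, hT, k, fun z => by rw [h, rot_pow_half hg, neg_one_mul]⟩

lemma mem_line_iff_coord (hg : 2 ≤ g) {k : ℕ} {z : Disk} {w : ℂ} (hw : w = (z : ℂ) / rot g ^ k) :
    z ∈ line g k ↔ vertexRadius g * (w.re ^ 2 + w.im ^ 2 + 1) - (1 + vertexRadius g ^ 2) * w.re =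
      2 * Real.cos (Real.pi / (4 * g)) * Real.sin (Real.pi / (4 * g)) * w.im := by
  have hCv := lineCenter_mul_vertexRadius hg
  have hv2 := one_add_vertexRadius_sq hg
  have hcs := Real.sin_sq_add_cos_sq (Real.pi / (4 * (g : ℝ)))
  have hv := vertexRadius_pos hg
  change ‖(z : ℂ) - lineCenter g * sideDir g k‖ ^ 2 = lineCenter g ^ 2 - 1 ↔ _
  rw [← norm_div_rot_sub, ← hw, ← Complex.normSq_eq_norm_sq, sideDir_zero, Complex.normSq_apply]
  simp only [Complex.sub_re, Complex.sub_im, Complex.mul_re, Complex.mul_im, Complex.add_re,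
    Complex.add_im, Complex.ofReal_re, Complex.ofReal_im, Complex.I_re, Complex.I_im, mul_zero,
    mul_one, zero_mul, sub_zero, add_zero, zero_add]
  generalize Real.cos (Real.pi / (4 * (g : ℝ))) = c at *
  generalize Real.sin (Real.pi / (4 * (g : ℝ))) = s at *
  generalize vertexRadius g = v at *
  generalize lineCenter g = C at *
  generalize w.re = x at *
  generalize w.im = y at *
  have key : v * ((x - C * c) * (x - C * c) + (y - C * s) * (y - C * s) - (C ^ 2 - 1)) =
      v * (x ^ 2 + y ^ 2 + 1) - (1 + v ^ 2) * x - 2 * c * s * y := by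
    linear_combination (-2 * (c * x + s * y)) * hCv + x * hv2 + v * C ^ 2 * hcs
  constructor
  · intro h
    rw [h] at key
    linarith
  · intro h
    rw [h] at key
    have : v * ((x - C * c) * (x - C * c) + (y - C * s) * (y - C * s) - (C ^ 2 - 1)) = 0 := by
      linarith
    linarith [(mul_eq_zero.mp this).resolve_left hv.ne']

/-- A half-turn about the vertex `v` on the real axis maps the geodesics through `v` to
themselves, and it decreases the distance to `0` of the points of the geodesic with inclination
given by `a` which lie below the real axis. -/
lemma half_turn {v a x y x' y' : ℝ} (hv0 : 0 < v) (hv1 : v < 1) (ha : 0 < a)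
    (hre : x' * (1 + v ^ 2 - 2 * v * x) + y' * (2 * v * y) = 2 * v - (1 + v ^ 2) * x)
    (him : y' * (1 + v ^ 2 - 2 * v * x) - x' * (2 * v * y) = -(1 + v ^ 2) * y)
    (hxy : x ^ 2 + y ^ 2 ≤ 1)
    (hline : v * (x ^ 2 + y ^ 2 + 1) - (1 + v ^ 2) * x = a * y) :
    v * (x' ^ 2 + y' ^ 2 + 1) - (1 + v ^ 2) * x' = a * y' ∧
      (y < 0 → x ^ 2 + y ^ 2 < 1 → x' ^ 2 + y' ^ 2 < x ^ 2 + y ^ 2) := by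
  set N := (1 + v ^ 2 - 2 * v * x) ^ 2 + (2 * v * y) ^ 2 with hN
  have hN0 : 0 < N := by
    have hx : x ≤ 1 := by nlinarith [sq_nonneg y]
    have : 0 < 1 + v ^ 2 - 2 * v * x := by nlinarith
    positivity
  have h1 : N * x' = (1 + v ^ 2 - 2 * v * x) * (2 * v - (1 + v ^ 2) * x)
      + (2 * v * y) * ((1 + v ^ 2) * y) := by
    linear_combination (1 + v ^ 2 - 2 * v * x) * hre - (2 * v * y) * him
  have h2 : N * y' = -(1 - v ^ 2) ^ 2 * y := by
    linear_combination (1 + v ^ 2 - 2 * v * x) * him + (2 * v * y) * hre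
  have h3 : N * (x' ^ 2 + y' ^ 2) = (2 * v - (1 + v ^ 2) * x) ^ 2 + ((1 + v ^ 2) * y) ^ 2 := by
    linear_combination (x' * (1 + v ^ 2 - 2 * v * x) + y' * (2 * v * y)
      + (2 * v - (1 + v ^ 2) * x)) * hre + (y' * (1 + v ^ 2 - 2 * v * x) - x' * (2 * v * y)
      - (1 + v ^ 2) * y) * him
  constructor
  · apply mul_left_cancel₀ hN0.ne'
    linear_combination v * h3 - (1 + v ^ 2) * h1 - a * h2 - (1 - v ^ 2) ^ 2 * hline
  · intro hy hlt
    have hNlt : N < (1 - v ^ 2) ^ 2 := by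
      have : N - (1 - v ^ 2) ^ 2 = 4 * v * (a * y) := by rw [← hline, hN]; ring
      have : v * (a * y) < 0 := mul_neg_of_pos_of_neg hv0 (mul_neg_of_pos_of_neg ha hy)
      linarith
    have h4 : N * (1 - (x' ^ 2 + y' ^ 2)) = (1 - v ^ 2) ^ 2 * (1 - (x ^ 2 + y ^ 2)) := by
      rw [mul_sub, h3, hN]
      ring
    have h5 : N * (1 - (x ^ 2 + y ^ 2)) < N * (1 - (x' ^ 2 + y' ^ 2)) := by
      rw [h4]
      exact mul_lt_mul_of_pos_right hNlt (by linarith)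
    linarith [lt_of_mul_lt_mul_left h5 hN0.le]

/-- After the rotation that takes the `i`-th side to the first one, the points of its geodesic below
the real axis are those beyond the initial vertex. They are moved towards `0` by an element of `Γ₀`
which acts, up to symmetries of the polygon, as the half-turn about that vertex. -/
lemma exists_norm_lt_of_im_neg (hg : 2 ≤ g) (i : Fin (4 * g)) :
    ∃ T ∈ Γ₀ g, ∃ k : Fin (4 * g), MapsTo T (line g i) (line g k) ∧
      ∀ z ∈ line g i, ‖(z : ℂ)‖ < 1 → ((z : ℂ) / rot g ^ (i : ℕ)).im < 0 →
        ‖(T z : ℂ)‖ < ‖(z : ℂ)‖ := by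
  obtain ⟨T, hT, k, hTk⟩ := exists_vertexCoord_eq_neg hg i
  have key : ∀ z ∈ line g i, T z ∈ line g k ∧ (‖(z : ℂ)‖ < 1 →
      ((z : ℂ) / rot g ^ (i : ℕ)).im < 0 → ‖(T z : ℂ)‖ < ‖(z : ℂ)‖) := by
    intro z hz
    obtain ⟨w, hw⟩ : ∃ w, w = (z : ℂ) / rot g ^ (i : ℕ) := ⟨_, rfl⟩
    obtain ⟨w', hw'⟩ : ∃ w', w' = (T z : ℂ) / rot g ^ (k : ℕ) := ⟨_, rfl⟩
    have hwn : ‖w‖ = ‖(z : ℂ)‖ := by rw [hw, norm_div, norm_pow, norm_rot, one_pow, div_one]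
    have hwn' : ‖w'‖ = ‖(T z : ℂ)‖ := by rw [hw', norm_div, norm_pow, norm_rot, one_pow, div_one]
    have hz1 : ‖w‖ ≤ 1 := hwn.trans_le (mem_closedBall_zero_iff.mp z.2)
    have hz1' : ‖w'‖ ≤ 1 := hwn'.trans_le (mem_closedBall_zero_iff.mp (T z).2)
    have h := hTk z
    rw [← hw, ← hw', vertexCoord, vertexCoord, ← neg_div, div_eq_div_iff
      (vertexCoord_denom_ne hg hz1') (vertexCoord_denom_ne hg hz1)] at h
    have h' : w' * (1 + vertexRadius g ^ 2 - 2 * vertexRadius g * w) =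
        2 * vertexRadius g - (1 + vertexRadius g ^ 2) * w := by linear_combination h
    have hre := congrArg Complex.re h'
    have him := congrArg Complex.im h'
    have hline := (mem_line_iff_coord hg hw).mp hz
    rw [← Complex.ofReal_pow] at hre him
    simp only [Complex.mul_re, Complex.mul_im, Complex.sub_re, Complex.sub_im, Complex.add_re,
      Complex.add_im, Complex.ofReal_re, Complex.ofReal_im, Complex.one_re, Complex.one_im,
      Complex.re_ofNat, Complex.im_ofNat] at hre him
    have hsq : ‖w‖ ^ 2 = w.re ^ 2 + w.im ^ 2 := by
      rw [← Complex.normSq_eq_norm_sq, Complex.normSq_apply]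
      ring
    have hsq' : ‖w'‖ ^ 2 = w'.re ^ 2 + w'.im ^ 2 := by
      rw [← Complex.normSq_eq_norm_sq, Complex.normSq_apply]
      ring
    have hturn := half_turn (x' := w'.re) (y' := w'.im) (vertexRadius_pos hg)
      (vertexRadius_lt_one hg) (mul_pos (mul_pos two_pos (cos_side_pos hg)) (sin_side_pos hg))
      (by linear_combination hre) (by linear_combination him)
      (by rw [← hsq]; nlinarith [norm_nonneg w]) hline
    refine ⟨(mem_line_iff_coord hg hw').mpr hturn.1, fun hlt hneg => ?_⟩
    rw [← hwn, ← hwn']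
    rw [← hw] at hneg
    rw [← hwn] at hlt
    have := hturn.2 hneg (by rw [← hsq]; nlinarith [norm_nonneg w])
    rw [← hsq, ← hsq'] at this
    exact lt_of_pow_lt_pow_left₀ 2 (norm_nonneg w) this
  exact ⟨T, hT, k, fun z hz => (key z hz).1, fun z hz => (key z hz).2⟩

/-- On the geodesic carrying a side, the side pairing acts as a Euclidean reflection. -/
lemma gen_eq_on_line (hg : 2 ≤ g) (i : Fin (4 * g)) {z : Disk} (hz : z ∈ line g i) :
    (gen g i z : ℂ) =
      sideDir g (partner i) * sideDir g i * starRingEnd ℂ (z : ℂ) := by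
  have hne : (z : ℂ) - lineCenter g * sideDir g i ≠ 0 :=
    pairing_denom_ne (one_lt_lineCenter hg) (norm_sideDir g i) (mem_closedBall_zero_iff.mp z.2)
  have h1 : ((z : ℂ) - lineCenter g * sideDir g i) *
      starRingEnd ℂ ((z : ℂ) - lineCenter g * sideDir g i) = lineCenter g ^ 2 - 1 := by
    rw [Complex.mul_conj, Complex.normSq_eq_norm_sq,
      show ‖(z : ℂ) - lineCenter g * sideDir g i‖ ^ 2 = lineCenter g ^ 2 - 1 from hz]
    push_cast
    rfl
  have h2 : sideDir g i * starRingEnd ℂ (sideDir g i) = 1 := by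
    rw [Complex.mul_conj, Complex.normSq_eq_norm_sq, norm_sideDir]
    norm_num
  rw [map_sub, map_mul, Complex.conj_ofReal] at h1
  rw [coe_gen hg, div_eq_iff hne]
  linear_combination (-sideDir g (partner i) * sideDir g i) * h1
    + sideDir g (partner i) * (lineCenter g ^ 2 * sideDir g i - lineCenter g * z) * h2

lemma mapsTo_gen_line (hg : 2 ≤ g) (i : Fin (4 * g)) :
    MapsTo (gen g i) (line g i) (line g (partner i)) := by
  intro z hz
  change ‖(gen g i z : ℂ) - lineCenter g * sideDir g (partner i)‖ ^ 2 = _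
  have h2 : sideDir g i * starRingEnd ℂ (sideDir g i) = 1 := by
    rw [Complex.mul_conj, Complex.normSq_eq_norm_sq, norm_sideDir]
    norm_num
  have h3 : (gen g i z : ℂ) - lineCenter g * sideDir g (partner i) =
      sideDir g (partner i) * sideDir g i *
        starRingEnd ℂ ((z : ℂ) - lineCenter g * sideDir g i) := by
    rw [gen_eq_on_line hg i hz, map_sub, map_mul, Complex.conj_ofReal]
    linear_combination (sideDir g (partner i) * lineCenter g) * h2
  rw [h3, norm_mul, norm_mul, norm_sideDir, norm_sideDir, RCLike.norm_conj, one_mul, one_mul]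
  exact hz

/-- A point of the geodesic through a side which does not lie on the side is moved towards `0`
by an element of `Γ₀` that maps this geodesic to the geodesic through a side. -/
lemma exists_norm_lt (hg : 2 ≤ g) (i : Fin (4 * g)) {z : Disk} (hz : z ∈ line g i)
    (hz1 : ‖(z : ℂ)‖ < 1) (hzv : vertexRadius g < ‖(z : ℂ)‖) :
    ∃ T ∈ Γ₀ g, ∃ k : Fin (4 * g), MapsTo T (line g i) (line g k) ∧ ‖(T z : ℂ)‖ < ‖(z : ℂ)‖ := by
  obtain ⟨w, hw⟩ : ∃ w, w = (z : ℂ) / rot g ^ (i : ℕ) := ⟨_, rfl⟩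
  by_cases him : w.im < 0
  · obtain ⟨T, hT, k, hmaps, hlt⟩ := exists_norm_lt_of_im_neg hg i
    exact ⟨T, hT, k, hmaps, hlt z hz hz1 (hw ▸ him)⟩
  have hgen := gen_eq_on_line hg i hz
  have hnorm : ‖(gen g i z : ℂ)‖ = ‖(z : ℂ)‖ := by
    rw [hgen, norm_mul, norm_mul, norm_sideDir, norm_sideDir, RCLike.norm_conj, one_mul, one_mul]
  have hrotconj : rot g ^ (i : ℕ) * starRingEnd ℂ (rot g ^ (i : ℕ)) = 1 := by
    rw [Complex.mul_conj, Complex.normSq_eq_norm_sq, norm_pow, norm_rot]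
    norm_num
  have hgenw : (gen g i z : ℂ) / rot g ^ (partner i : ℕ) =
      sideDir g 0 ^ 2 * starRingEnd ℂ w := by
    have hr := rot_ne_zero g
    have hz' : (z : ℂ) = rot g ^ (i : ℕ) * w := by rw [hw]; field_simp
    rw [hgen, hz', map_mul, sideDir_eq g i, sideDir_eq g (partner i), div_eq_iff (pow_ne_zero _ hr)]
    linear_combination (sideDir g 0 ^ 2 * rot g ^ (partner i : ℕ) * starRingEnd ℂ w) * hrotconj
  by_cases him' : (sideDir g 0 ^ 2 * starRingEnd ℂ w).im < 0
  · obtain ⟨T, hT, k, hmaps, hlt⟩ := exists_norm_lt_of_im_neg hg (partner i)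
    refine ⟨T * gen g i, mul_mem hT (gen_mem g i), k, hmaps.comp (mapsTo_gen_line hg i), ?_⟩
    have := hlt (gen g i z) (mapsTo_gen_line hg i hz) (by rwa [hnorm]) (by rwa [hgenw])
    rwa [hnorm] at this
  -- otherwise `z` lies on the side
  exfalso
  push Not at him him'
  have hwn : ‖w‖ = ‖(z : ℂ)‖ := by rw [hw, norm_div, norm_pow, norm_rot, one_pow, div_one]
  have hline := (mem_line_iff_coord hg hw).mp hz
  have hs := sin_side_pos hg
  have hc := cos_side_pos hg
  have hv := vertexRadius_pos hg
  have hv1 := vertexRadius_lt_one hg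
  have hv2 := one_add_vertexRadius_sq hg
  have hcs := Real.sin_sq_add_cos_sq (Real.pi / (4 * (g : ℝ)))
  have hsq : ‖w‖ ^ 2 = w.re ^ 2 + w.im ^ 2 := by
    rw [← Complex.normSq_eq_norm_sq, Complex.normSq_apply]
    ring
  rw [sideDir_zero, sq] at him'
  simp only [Complex.mul_im, Complex.mul_re, Complex.add_re, Complex.add_im, Complex.ofReal_re,
    Complex.ofReal_im, Complex.I_re, Complex.I_im, Complex.conj_re, Complex.conj_im] at him'
  rw [← hwn] at hz1 hzv
  generalize Real.cos (Real.pi / (4 * (g : ℝ))) = c at *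
  generalize Real.sin (Real.pi / (4 * (g : ℝ))) = s at *
  generalize vertexRadius g = v at *
  generalize w.re = x at *
  generalize w.im = y at *
  have hr0 : 0 ≤ ‖w‖ := norm_nonneg w
  generalize ‖w‖ = r at *
  -- the coordinates along the direction of the midpoint of the side and across it
  obtain ⟨a, ha⟩ : ∃ a, a = c * x + s * y := ⟨_, rfl⟩
  obtain ⟨b, hb⟩ : ∃ b, b = c * y - s * x := ⟨_, rfl⟩
  have h1 : y = s * a + c * b := by rw [ha, hb]; linear_combination (-y) * hcs
  have h2 : 0 ≤ s * a - c * b := by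
    rw [ha, hb]
    linarith
  have h3 : 0 ≤ s * a + c * b := h1 ▸ him
  have ha0 : 0 ≤ a := by
    by_contra! h
    nlinarith
  have hab : a ^ 2 + b ^ 2 = r ^ 2 := by
    rw [hsq, ha, hb]
    linear_combination (x ^ 2 + y ^ 2) * hcs
  have h4 : (c * r) ^ 2 ≤ a ^ 2 := by
    have : (c * b) ^ 2 ≤ (s * a) ^ 2 := by nlinarith
    nlinarith
  have h5 : c * r ≤ a := le_of_sq_le_sq h4 ha0
  have h6 : v * (r ^ 2 + 1) = 2 * c * a := by
    rw [hsq, ha]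
    linear_combination hline + x * hv2
  have h7 : (r - v) * (1 - v * r) ≤ 0 := by nlinarith
  have h8 : 0 < 1 - v * r := by nlinarith
  nlinarith

end Polygon

/-! ### Discreteness of `Γ₀` and finiteness of the cut set -/

lemma IsSurfaceGroup.mem_circle_iff {Γ : Subgroup (Disk ≃ₜ Disk)} (hΓ : IsSurfaceGroup Γ)
    {γ : Disk ≃ₜ Disk} (hγ : γ ∈ Γ) {z : Disk} : γ z ∈ circle ↔ z ∈ circle := by
  refine ⟨fun h => ?_, (hΓ.mobius γ hγ).mem_circle⟩
  have h' := (hΓ.mobius _ (inv_mem hγ)).mem_circle h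
  rwa [← Homeomorph.mul_apply, inv_mul_cancel, Homeomorph.one_apply] at h'

lemma norm_lt_one_iff {z : Disk} : ‖(z : ℂ)‖ < 1 ↔ z ∉ circle :=
  (mem_closedBall_zero_iff.mp z.2).lt_iff_ne

lemma finite_circle_inter_line {g : ℕ} (hg : 2 ≤ g) (k : ℕ) :
    (circle ∩ line g k).Finite := by
  have hC := one_lt_lineCenter hg
  set u := sideDir g k with hu
  have hu1 : ‖u‖ = 1 := norm_sideDir g k
  have hu0 : u ≠ 0 := sideDir_ne_zero g k
  set y : ℝ := Real.sqrt (1 - (1 / lineCenter g) ^ 2) with hy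
  have hfin : ({u * ⟨1 / lineCenter g, y⟩, u * ⟨1 / lineCenter g, -y⟩} : Set ℂ).Finite :=
    toFinite _
  refine (hfin.preimage (f := (Subtype.val : Disk → ℂ)) Subtype.val_injective.injOn).subset ?_
  rintro z ⟨hz, hzl⟩
  obtain ⟨w, hw⟩ : ∃ w : ℂ, (z : ℂ) = u * w := ⟨z / u, by field_simp⟩
  have hw1 : ‖w‖ = 1 := by
    have : ‖(z : ℂ)‖ = 1 := hz
    rwa [hw, norm_mul, hu1, one_mul] at this
  have hw2 : ‖w - lineCenter g‖ ^ 2 = lineCenter g ^ 2 - 1 := by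
    have h : ‖(z : ℂ) - lineCenter g * u‖ ^ 2 = lineCenter g ^ 2 - 1 := hzl
    rwa [show (z : ℂ) - lineCenter g * u = u * (w - lineCenter g) by rw [hw]; ring, norm_mul, hu1,
      one_mul] at h
  have hw1' : w.re ^ 2 + w.im ^ 2 = 1 := by
    have h : Complex.normSq w = 1 := by rw [Complex.normSq_eq_norm_sq, hw1, one_pow]
    rw [Complex.normSq_apply] at h
    linarith
  rw [← Complex.normSq_eq_norm_sq, Complex.normSq_apply, Complex.sub_re, Complex.sub_im,
    Complex.ofReal_re, Complex.ofReal_im, sub_zero] at hw2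
  have hre : w.re = 1 / lineCenter g := by
    rw [eq_div_iff (by linarith)]
    linarith
  have him : w.im = y ∨ w.im = -y := by
    apply sq_eq_sq_iff_eq_or_eq_neg.mp
    rw [hy, Real.sq_sqrt]
    · rw [← hre]
      linarith
    · rw [← hre]
      nlinarith
  rw [mem_preimage, hw]
  rcases him with h | h
  · exact Or.inl (by rw [← hre, ← h])
  · exact Or.inr (by rw [mem_singleton_iff, ← hre, ← h])

namespace MarkedSurface

variable {g : ℕ} (X : MarkedSurface g)
include X

lemma mem_circle_iff {γ : Disk ≃ₜ Disk} (hγ : γ ∈ Γ₀ g) {z : Disk} : γ z ∈ circle ↔ z ∈ circle := by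
  rw [← X.lift_mem_circle (γ z), X.equivariant ⟨γ, hγ⟩ z,
    X.isSurfaceGroup.mem_circle_iff (X.φ ⟨γ, hγ⟩).2, X.lift_mem_circle]

lemma norm_lt_one_iff {γ : Disk ≃ₜ Disk} (hγ : γ ∈ Γ₀ g) {z : Disk} :
    ‖(γ z : ℂ)‖ < 1 ↔ ‖(z : ℂ)‖ < 1 := by
  rw [ScalingFunction.norm_lt_one_iff, ScalingFunction.norm_lt_one_iff, X.mem_circle_iff hγ]

/-- The group `Γ₀` acts properly discontinuously on the open disk, because the marking conjugates
it to the Fuchsian group of `X`. -/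
lemma properlyDiscontinuous {ρ : ℝ} (hρ : ρ < 1) :
    {γ | γ ∈ Γ₀ g ∧ ∃ z : Disk, ‖(z : ℂ)‖ ≤ ρ ∧ ‖(γ z : ℂ)‖ ≤ ρ}.Finite := by
  obtain ⟨ρ', hρ', hle⟩ : ∃ ρ' : ℝ, ρ' < 1 ∧
      ∀ z : Disk, ‖(z : ℂ)‖ ≤ ρ → ‖(X.lift z : ℂ)‖ ≤ ρ' := by
    have hcpt : IsCompact {z : Disk | ‖(z : ℂ)‖ ≤ ρ} :=
      (isClosed_le (by fun_prop) continuous_const).isCompact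
    by_cases hne : {z : Disk | ‖(z : ℂ)‖ ≤ ρ}.Nonempty
    · have hcont : Continuous fun z : Disk => ‖(X.lift z : ℂ)‖ :=
        continuous_norm.comp (continuous_subtype_val.comp X.lift.continuous)
      obtain ⟨z, hz, hmax⟩ := hcpt.exists_isMaxOn hne hcont.continuousOn
      refine ⟨_, ?_, fun w hw => hmax hw⟩
      rw [ScalingFunction.norm_lt_one_iff, X.lift_mem_circle, ← ScalingFunction.norm_lt_one_iff]
      exact lt_of_le_of_lt hz hρ
    · exact ⟨0, one_pos, fun z hz => (hne ⟨z, hz⟩).elim⟩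
  have hfin := X.isSurfaceGroup.properlyDiscontinuous ρ' hρ'
  refine (hfin.preimage (f := fun γ : Γ₀ g => ((X.φ γ).1 : Disk ≃ₜ Disk)) ?_).image
    Subtype.val |>.subset ?_
  · exact (Subtype.val_injective.comp X.φ.injective).injOn
  · rintro γ ⟨hγ, z, hz, hγz⟩
    refine ⟨⟨γ, hγ⟩, ⟨(X.φ _).2, X.lift z, hle z hz, ?_⟩, rfl⟩
    rw [← X.equivariant]
    exact hle _ hγz

/-- Every point of the geodesic through a side can be moved to a point on a side by an element of
`Γ₀` that maps the geodesic to the geodesic through that side: the geodesics of the net consist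
of edges. -/
lemma exists_norm_le_vertexRadius (hg : 2 ≤ g) (i : Fin (4 * g)) {z : Disk} (hz : z ∈ line g i)
    (hz1 : ‖(z : ℂ)‖ < 1) : ∃ δ ∈ Γ₀ g, ∃ k : Fin (4 * g),
      MapsTo δ (line g i) (line g k) ∧ ‖(δ z : ℂ)‖ ≤ vertexRadius g := by
  set A := {δ : Disk ≃ₜ Disk | (δ ∈ Γ₀ g ∧ ∃ k : Fin (4 * g), MapsTo δ (line g i) (line g k)) ∧
    ‖(δ z : ℂ)‖ ≤ ‖(z : ℂ)‖} with hA
  have hfin : A.Finite :=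
    (X.properlyDiscontinuous hz1).subset fun δ hδ => ⟨hδ.1.1, z, le_rfl, hδ.2⟩
  have hne : A.Nonempty := ⟨1, ⟨one_mem _, i, mapsTo_id _⟩, le_rfl⟩
  obtain ⟨δ, ⟨⟨hδ, k, hk⟩, hδz⟩, hmin⟩ := hfin.exists_minimalFor (fun δ => ‖(δ z : ℂ)‖) A hne
  refine ⟨δ, hδ, k, hk, ?_⟩
  by_contra! hlt
  obtain ⟨T, hT, k', hk', hTlt⟩ :=
    exists_norm_lt hg k (hk hz) ((X.norm_lt_one_iff hδ).mpr hz1) hlt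
  have hle := hmin (j := T * δ)
    ⟨⟨mul_mem hT hδ, k', hk'.comp hk⟩, hTlt.le.trans hδz⟩ hTlt.le
  exact absurd hTlt (not_lt.mpr hle)

/-- Only finitely many geodesics of the net pass through a given point. -/
lemma finite_idealEndpoints (hg : 2 ≤ g) {p : Disk} (hp : ‖(p : ℂ)‖ < 1) :
    (idealEndpoints g p).Finite := by
  set ρ := max (vertexRadius g) ‖(p : ℂ)‖ with hρ
  have hfin := X.properlyDiscontinuous (max_lt (vertexRadius_lt_one hg) hp)
  rw [← hρ] at hfin
  refine (hfin.biUnion (t := fun γ => ⋃ k : Fin (4 * g), γ '' (circle ∩ line g k))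
    fun γ _ => finite_iUnion fun k => (finite_circle_inter_line hg k).image _).subset ?_
  rintro x ⟨hx, γ, hγ, i, ⟨q, hq, hqp⟩, ⟨y, hy, hyx⟩⟩
  have hq1 : ‖(q : ℂ)‖ < 1 := by rwa [← X.norm_lt_one_iff hγ, hqp]
  obtain ⟨δ, hδ, k, hk, hle⟩ := X.exists_norm_le_vertexRadius hg i hq hq1
  have hcancel : ∀ z, (γ * δ⁻¹) (δ z) = γ z := fun z => by
    rw [← Homeomorph.mul_apply, inv_mul_cancel_right]
  refine mem_biUnion (x := γ * δ⁻¹) ⟨mul_mem hγ (inv_mem hδ), δ q, hle.trans (le_max_left _ _), ?_⟩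
    (mem_iUnion.mpr ⟨k, δ y, ⟨?_, hk hy⟩, ?_⟩)
  · rw [hcancel, hqp]
    exact le_max_right _ _
  · rwa [X.mem_circle_iff hδ, ← X.mem_circle_iff hγ, hyx]
  · rw [hcancel, hyx]

lemma finite_neighbourVertices (hg : 2 ≤ g) : (neighbourVertices g).Finite := by
  have hfin := X.properlyDiscontinuous (vertexRadius_lt_one hg)
  refine (hfin.biUnion (t := fun γ => ⋃ i : Fin (4 * g), {γ (vertex g i), γ (vertex g (i + 1))})
    fun γ _ => finite_iUnion fun k => toFinite _).subset ?_
  rintro p ⟨-, j, γ, hγ, i, ⟨hj, hp⟩ | ⟨hp, hj⟩⟩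
  · exact mem_biUnion (x := γ) ⟨hγ, _, (norm_vertex g i).le, hj ▸ (norm_vertex g j).le⟩
      (mem_iUnion.mpr ⟨i, Or.inr hp⟩)
  · exact mem_biUnion (x := γ) ⟨hγ, _, (norm_vertex g (i + 1)).le, hj ▸ (norm_vertex g j).le⟩
      (mem_iUnion.mpr ⟨i, Or.inl hp⟩)

lemma finite_cutSet (hg : 2 ≤ g) : (cutSet g).Finite := by
  refine (X.finite_neighbourVertices hg).biUnion fun p hp => X.finite_idealEndpoints hg ?_
  obtain ⟨-, j, γ, hγ, i, ⟨-, rfl⟩ | ⟨rfl, -⟩⟩ := hp <;>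
  · rw [X.norm_lt_one_iff hγ, norm_vertex]
    exact vertexRadius_lt_one hg

end MarkedSurface

/-! ### The intervals of the initial partition -/

lemma subset_connectedComponentIn_of_angles {W : Set Disk} {S : Set ℝ} (hS : IsPreconnected S)
    (hSW : ∀ θ ∈ S, circlePoint θ ∉ W) {θ : ℝ} (hθ : θ ∈ S) :
    circlePoint '' S ⊆ connectedComponentIn (circle \ W) (circlePoint θ) := by
  refine (hS.image _ continuous_circlePoint.continuousOn).subset_connectedComponentIn
    (mem_image_of_mem _ hθ) ?_
  rintro _ ⟨t, ht, rfl⟩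
  exact ⟨circlePoint_mem t, hSW t ht⟩

/-- A finite set cuts the circle into finitely many components: the component of a point is
determined by the set of cut points with smaller argument. -/
lemma finite_interval {g : ℕ} (hW : (cutSet g).Finite) : Finite (Interval g) := by
  set F : Set ℝ := Ioc (-Real.pi) Real.pi ∩ circlePoint ⁻¹' cutSet g with hF
  have hFfin : F.Finite := by
    refine Finite.of_finite_image (f := circlePoint) (hW.subset ?_)
      (injOn_circlePoint.mono inter_subset_left)
    rintro _ ⟨θ, hθ, rfl⟩
    exact hθ.2
  have hangle : ∀ I : Interval g, ∃ θ ∈ Ioc (-Real.pi) Real.pi, circlePoint θ ∉ cutSet g ∧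
      I.1 = closure (connectedComponentIn (circle \ cutSet g) (circlePoint θ)) := by
    rintro ⟨I, x, hx, hI⟩
    obtain ⟨θ, hθ, rfl⟩ := exists_circlePoint_eq hx.1
    exact ⟨θ, hθ, hx.2, hI⟩
  choose θ hθ hθW hI using hangle
  have : Finite {b : Set ℝ // b ⊆ F} := hFfin.finite_subsets
  refine Finite.of_injective
    (fun I : Interval g => (⟨{t ∈ F | t < θ I}, sep_subset _ _⟩ : {b : Set ℝ // b ⊆ F})) ?_
  intro I J h
  wlog hle : θ I ≤ θ J generalizing I J
  · exact (this h.symm (le_of_not_ge hle)).symm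
  have hset : {t ∈ F | t < θ I} = {t ∈ F | t < θ J} := congrArg Subtype.val h
  refine Subtype.ext ?_
  rw [hI I, hI J, ← connectedComponentIn_eq (y := circlePoint (θ J))]
  refine subset_connectedComponentIn_of_angles (S := Icc (θ I) (θ J)) isPreconnected_Icc ?_
    (left_mem_Icc.mpr hle) (mem_image_of_mem _ (right_mem_Icc.mpr hle))
  intro t ht htW
  have htJ : t < θ J := lt_of_le_of_ne ht.2 (by rintro rfl; exact hθW J htW)
  have htF : t ∈ {t ∈ F | t < θ J} := ⟨⟨⟨(hθ I).1.trans_le ht.1, ht.2.trans (hθ J).2⟩, htW⟩, htJ⟩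
  rw [← hset] at htF
  exact absurd htF.2 (not_lt.mpr ht.1)

lemma exists_isOpen_circle_inter_subset {S : Set ℝ} (hS : IsOpen S) {θ : ℝ} (hθ : θ ∈ S) :
    ∃ V : Set Disk, IsOpen V ∧ circlePoint θ ∈ V ∧ circle ∩ V ⊆ circlePoint '' S := by
  have hopen := isLocalHomeomorph_circleExp.isOpenMap S hS
  obtain ⟨V, hV, hVS⟩ := isOpen_induced_iff.mp hopen
  refine ⟨Subtype.val ⁻¹' V, hV.preimage continuous_subtype_val, ?_, ?_⟩
  · have : Circle.exp θ ∈ Subtype.val ⁻¹' V := hVS ▸ mem_image_of_mem _ hθ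
    exact this
  · rintro z ⟨hz, hzV⟩
    have hz' : (⟨z, mem_sphere_zero_iff_norm.mpr hz⟩ : Circle) ∈ Circle.exp '' S := by
      rw [← hVS]
      exact hzV
    obtain ⟨t, ht, htz⟩ := hz'
    exact ⟨t, ht, Subtype.ext (congrArg (fun w : Circle => (w : ℂ)) htz)⟩

namespace Interval

variable {g : ℕ} (I : Interval g)

lemma isClosed : IsClosed I.1 := by
  obtain ⟨x, -, h⟩ := I.2
  rw [h]
  exact isClosed_closure

lemma subset_circle : I.1 ⊆ circle := by
  obtain ⟨x, -, h⟩ := I.2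
  rw [h]
  exact closure_minimal ((connectedComponentIn_subset _ _).trans sdiff_subset) isClosed_circle

/-- An interval of the partition is the closure of its interior relative to the circle. -/
lemma exists_isOpen_closure_eq (hW : (cutSet g).Finite) :
    ∃ U : Set Disk, IsOpen U ∧ (circle ∩ U).Nonempty ∧ I.1 = closure (circle ∩ U) := by
  obtain ⟨x, hx, hI⟩ := I.2
  set O := connectedComponentIn (circle \ cutSet g) x with hO
  have hlocal : ∀ y ∈ O, ∃ V : Set Disk, IsOpen V ∧ y ∈ V ∧ circle ∩ V ⊆ O := by
    intro y hy
    have hyc := connectedComponentIn_subset _ _ hy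
    obtain ⟨θ, -, rfl⟩ := exists_circlePoint_eq hyc.1
    have hopen : IsOpen (circlePoint ⁻¹' cutSet g)ᶜ :=
      (hW.isClosed.preimage continuous_circlePoint).isOpen_compl
    obtain ⟨ε, hε, hball⟩ := Metric.isOpen_iff.mp hopen θ hyc.2
    obtain ⟨V, hV, hθV, hsub⟩ :=
      exists_isOpen_circle_inter_subset Metric.isOpen_ball (Metric.mem_ball_self hε)
    refine ⟨V, hV, hθV, hsub.trans ?_⟩
    rw [hO, connectedComponentIn_eq hy]
    exact subset_connectedComponentIn_of_angles (Real.ball_eq_Ioo θ ε ▸ isPreconnected_Ioo)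
      (fun t ht => hball ht) (Metric.mem_ball_self hε)
  choose! V hV hyV hVO using hlocal
  have hOU : circle ∩ (⋃ y ∈ O, V y) = O := by
    apply Subset.antisymm
    · rintro z ⟨hz, hzU⟩
      obtain ⟨y, hy, hzy⟩ := mem_iUnion₂.mp hzU
      exact hVO y hy ⟨hz, hzy⟩
    · intro y hy
      exact ⟨(connectedComponentIn_subset _ _ hy).1, mem_biUnion hy (hyV y hy)⟩
  refine ⟨⋃ y ∈ O, V y, isOpen_biUnion hV, ?_, by rw [hOU, hI]⟩
  rw [hOU]
  exact ⟨x, mem_connectedComponentIn hx⟩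

end Interval

/-! ### Contraction of the inverse branches for the standard surface -/

section Gen

variable {g : ℕ}

lemma norm_gen_sub_mul (hg : 2 ≤ g) (i : Fin (4 * g)) (z : Disk) :
    ‖(gen g i z : ℂ) - lineCenter g * sideDir g (partner i)‖ *
      ‖(z : ℂ) - lineCenter g * sideDir g i‖ = lineCenter g ^ 2 - 1 := by
  have hC := one_lt_lineCenter hg
  have hne : (z : ℂ) - lineCenter g * sideDir g i ≠ 0 :=
    pairing_denom_ne hC (norm_sideDir g i) (mem_closedBall_zero_iff.mp z.2)
  have h : ((gen g i z : ℂ) - lineCenter g * sideDir g (partner i)) *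
      ((z : ℂ) - lineCenter g * sideDir g i) =
        sideDir g (partner i) * sideDir g i * ((lineCenter g ^ 2 - 1 : ℝ) : ℂ) := by
    rw [sub_mul, coe_gen hg, div_mul_cancel₀ _ hne]
    push_cast
    ring
  rw [← norm_mul, h, norm_mul, norm_mul, norm_sideDir, norm_sideDir, Complex.norm_real, one_mul,
    one_mul, Real.norm_of_nonneg (by nlinarith)]

lemma dist_gen_mul (hg : 2 ≤ g) (i : Fin (4 * g)) (z w : Disk) :
    dist (gen g i z) (gen g i w) * (‖(z : ℂ) - lineCenter g * sideDir g i‖ *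
      ‖(w : ℂ) - lineCenter g * sideDir g i‖) = (lineCenter g ^ 2 - 1) * dist z w := by
  have hC := one_lt_lineCenter hg
  have hnz : (z : ℂ) - lineCenter g * sideDir g i ≠ 0 :=
    pairing_denom_ne hC (norm_sideDir g i) (mem_closedBall_zero_iff.mp z.2)
  have hnw : (w : ℂ) - lineCenter g * sideDir g i ≠ 0 :=
    pairing_denom_ne hC (norm_sideDir g i) (mem_closedBall_zero_iff.mp w.2)
  have h : ((gen g i z : ℂ) - gen g i w) * (((z : ℂ) - lineCenter g * sideDir g i) *
      ((w : ℂ) - lineCenter g * sideDir g i)) =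
        -sideDir g (partner i) * sideDir g i * ((lineCenter g ^ 2 - 1 : ℝ) : ℂ) * (z - w) := by
    have h1 := div_mul_cancel₀
      ((sideDir g (partner i) : ℂ) * (lineCenter g * z - sideDir g i)) hnz
    have h2 := div_mul_cancel₀
      ((sideDir g (partner i) : ℂ) * (lineCenter g * w - sideDir g i)) hnw
    rw [← coe_gen hg] at h1 h2
    push_cast
    linear_combination ((w : ℂ) - lineCenter g * sideDir g i) * h1 -
      ((z : ℂ) - lineCenter g * sideDir g i) * h2
  rw [Subtype.dist_eq, Subtype.dist_eq, Complex.dist_eq, Complex.dist_eq, ← norm_mul, ← norm_mul, h,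
    norm_mul, norm_mul, norm_mul, norm_neg, norm_sideDir, norm_sideDir, Complex.norm_real, one_mul,
    one_mul, Real.norm_of_nonneg (by nlinarith)]

/-- Since the intervals lie strictly inside the isometric circles of their side pairings, the
inverse branches contract, uniformly on a neighbourhood of the intervals of fixed size. -/
lemma MarkovMap.exists_contraction (hg : 2 ≤ g) (f : MarkovMap g) [Finite (Interval g)] :
    ∃ ε θ : ℝ, 0 < ε ∧ 0 < θ ∧ θ < 1 ∧ ∀ I : Interval g, ∀ x ∈ I.1,
      (∀ y : Disk, dist (gen g (f.side I) y) (gen g (f.side I) x) ≤ ε →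
        dist y x ≤ θ * dist (gen g (f.side I) y) (gen g (f.side I) x)) ∧
      (∀ y ∈ I.1, dist y x ≤ θ * dist (gen g (f.side I) y) (gen g (f.side I) x)) := by
  have hC := one_lt_lineCenter hg
  have hR2 : 0 < lineCenter g ^ 2 - 1 := by nlinarith
  obtain ⟨R, hR, hRsq⟩ : ∃ R : ℝ, 0 < R ∧ R ^ 2 = lineCenter g ^ 2 - 1 :=
    ⟨_, Real.sqrt_pos.mpr hR2, Real.sq_sqrt hR2.le⟩
  have hnear : ∀ I : Interval g, ∃ r : ℝ, r < R ∧
      ∀ x ∈ I.1, ‖(x : ℂ) - lineCenter g * sideDir g (f.side I)‖ ≤ r := by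
    intro I
    by_cases hne : I.1.Nonempty
    · have hcont : ContinuousOn
          (fun x : Disk => ‖(x : ℂ) - lineCenter g * sideDir g (f.side I)‖) I.1 := by fun_prop
      obtain ⟨x, hx, hmax⟩ := I.isClosed.isCompact.exists_isMaxOn hne hcont
      refine ⟨_, ?_, fun y hy => hmax hy⟩
      refine lt_of_pow_lt_pow_left₀ 2 hR.le ?_
      rw [hRsq]
      exact (f.subset_openArc I hx).2
    · exact ⟨0, hR, fun x hx => (hne ⟨x, hx⟩).elim⟩
  choose r hrR hr using hnear
  obtain ⟨r₀, hr₀0, hr₀R, hr₀⟩ : ∃ r₀, 0 < r₀ ∧ r₀ < R ∧ ∀ I, r I ≤ r₀ := by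
    obtain ⟨M, hM⟩ : ∃ M < R, ∀ I, r I ≤ M := by
      rcases isEmpty_or_nonempty (Interval g) with h | h
      · exact ⟨R - 1, by linarith, fun I => (h.false I).elim⟩
      · obtain ⟨I, hI⟩ := Finite.exists_max r
        exact ⟨r I, hrR I, hI⟩
    exact ⟨max M (R / 2), lt_max_of_lt_right (by linarith), max_lt hM.1 (by linarith),
      fun I => (hM.2 I).trans (le_max_left _ _)⟩
  refine ⟨R ^ 2 / r₀ - R, r₀ / R, ?_, by positivity, (div_lt_one hR).mpr hr₀R, fun I x hx => ?_⟩
  · rw [sub_pos, lt_div_iff₀ hr₀0]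
    nlinarith
  have hxr := (hr I x hx).trans (hr₀ I)
  have key : ∀ y : Disk, ‖(y : ℂ) - lineCenter g * sideDir g (f.side I)‖ ≤ R →
      dist y x ≤ r₀ / R * dist (gen g (f.side I) y) (gen g (f.side I) x) := by
    intro y hy
    have h := dist_gen_mul hg (f.side I) y x
    rw [← hRsq] at h
    rw [div_mul_eq_mul_div, le_div_iff₀ hR]
    refine le_of_mul_le_mul_right ?_ hR
    calc dist y x * R * R = R ^ 2 * dist y x := by ring
      _ ≤ dist (gen g (f.side I) y) (gen g (f.side I) x) * (R * r₀) := by rw [← h]; gcongr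
      _ = r₀ * dist (gen g (f.side I) y) (gen g (f.side I) x) * R := by ring
  refine ⟨fun y hy => key y ?_, fun y hy => key y ((hr I y hy).trans ((hr₀ I).trans hr₀R.le))⟩
  -- the derivative of the inverse branch at `gen y` is still at most `1`
  have h1 := norm_gen_sub_mul hg (f.side I) x
  have h2 := norm_gen_sub_mul hg (f.side I) y
  rw [← hRsq] at h1 h2
  set a := ‖(gen g (f.side I) x : ℂ) - lineCenter g * sideDir g (partner (f.side I))‖ with ha
  set b := ‖(gen g (f.side I) y : ℂ) - lineCenter g * sideDir g (partner (f.side I))‖ with hb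
  have h3 : R ^ 2 / r₀ ≤ a := by
    rw [div_le_iff₀ hr₀0, ← h1]
    gcongr
  have h4 : a ≤ b + dist (gen g (f.side I) y) (gen g (f.side I) x) := by
    rw [ha, hb, Subtype.dist_eq, ← Complex.dist_eq, ← Complex.dist_eq,
      dist_comm (gen g (f.side I) y : ℂ) (gen g (f.side I) x)]
    linarith [dist_triangle (gen g (f.side I) x : ℂ) (gen g (f.side I) y)
      (lineCenter g * sideDir g (partner (f.side I)))]
  have h5 : R ≤ b := by linarith
  refine le_of_mul_le_mul_left ?_ hR
  calc R * ‖(y : ℂ) - lineCenter g * sideDir g (f.side I)‖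
      ≤ b * ‖(y : ℂ) - lineCenter g * sideDir g (f.side I)‖ := by gcongr
    _ = R * R := by rw [h2, sq]

end Gen

namespace MarkovMap.Dual

variable {g : ℕ} {f : MarkovMap g}

/-- The sequence `⋯ j_{k+1} j_k`, obtained by deleting the first `k` digits from the right. -/
def shift (w : f.Dual) (k : ℕ) : f.Dual := ⟨fun n => w.1 (k + n), fun n => w.2 (k + n)⟩

/-- The inverse branch of the `n`-th iterate of the Markov map along `j_n ⋯ j_1 j_0`, as an
element of `Γ₀`. -/
noncomputable def inverseBranch (w : f.Dual) : ℕ → Γ₀ g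
  | 0 => 1
  | n + 1 => (gen₀ g (f.side (w.1 (n + 1))))⁻¹ * inverseBranch w n

lemma inverseBranch_add (w : f.Dual) (m n : ℕ) :
    w.inverseBranch (m + n) = (w.shift m).inverseBranch n * w.inverseBranch m := by
  induction n with
  | zero => exact (one_mul _).symm
  | succ n ih =>
    change (gen₀ g (f.side (w.1 (m + n + 1))))⁻¹ * w.inverseBranch (m + n) = _
    rw [ih, ← mul_assoc]
    rfl

lemma gen_inverseBranch_succ (w : f.Dual) (n : ℕ) (z : Disk) :
    gen g (f.side (w.1 (n + 1))) ((w.inverseBranch (n + 1)).1 z) = (w.inverseBranch n).1 z := by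
  change gen g _ ((gen g _)⁻¹ ((w.inverseBranch n).1 z)) = _
  rw [← Homeomorph.mul_apply, mul_inv_cancel, Homeomorph.one_apply]

lemma inverseBranch_mem (w : f.Dual) (n : ℕ) {x : Disk} (hx : x ∈ (w.1 0).1) :
    (w.inverseBranch n).1 x ∈ (w.1 n).1 := by
  induction n with
  | zero => exact hx
  | succ n ih =>
    obtain ⟨y, hy, hyx⟩ := w.2 n ih
    rw [← w.gen_inverseBranch_succ n x] at hyx
    rwa [← (gen g (f.side (w.1 (n + 1)))).injective hyx]

lemma exists_dist_inverseBranch_le (hg : 2 ≤ g) [Finite (Interval g)] :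
    ∃ ε θ : ℝ, 0 < ε ∧ 0 < θ ∧ θ < 1 ∧ ∀ (w : f.Dual), ∀ x ∈ (w.1 0).1, ∀ n,
      (∀ y, dist y x ≤ ε →
        dist ((w.inverseBranch n).1 y) ((w.inverseBranch n).1 x) ≤ θ ^ n * dist y x) ∧
      (∀ y ∈ (w.1 0).1,
        dist ((w.inverseBranch n).1 y) ((w.inverseBranch n).1 x) ≤ θ ^ n * dist y x) := by
  obtain ⟨ε, θ, hε, hθ, hθ1, h⟩ := f.exists_contraction hg
  refine ⟨ε, θ, hε, hθ, hθ1, fun w x hx n => ⟨fun y hy => ?_, fun y hy => ?_⟩⟩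
  · induction n with
    | zero => exact (one_mul _).ge
    | succ n ih =>
      have h1 := (h (w.1 (n + 1)) _ (w.inverseBranch_mem (n + 1) hx)).1
        ((w.inverseBranch (n + 1)).1 y)
      rw [gen_inverseBranch_succ, gen_inverseBranch_succ] at h1
      have h2 : dist ((w.inverseBranch n).1 y) ((w.inverseBranch n).1 x) ≤ ε :=
        (ih.trans (mul_le_of_le_one_left dist_nonneg (pow_le_one₀ hθ.le hθ1.le))).trans hy
      calc _ ≤ θ * dist ((w.inverseBranch n).1 y) ((w.inverseBranch n).1 x) := h1 h2
        _ ≤ θ * (θ ^ n * dist y x) := by gcongr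
        _ = θ ^ (n + 1) * dist y x := by ring
  · induction n with
    | zero => exact (one_mul _).ge
    | succ n ih =>
      have h1 := (h (w.1 (n + 1)) _ (w.inverseBranch_mem (n + 1) hx)).2 _
        (w.inverseBranch_mem (n + 1) hy)
      rw [gen_inverseBranch_succ, gen_inverseBranch_succ] at h1
      calc _ ≤ θ * dist ((w.inverseBranch n).1 y) ((w.inverseBranch n).1 x) := h1
        _ ≤ θ * (θ ^ n * dist y x) := by gcongr
        _ = θ ^ (n + 1) * dist y x := by ring

end MarkovMap.Dual

/-! ### Contraction of the inverse branches for a marked surface -/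

namespace MarkedSurface

variable {g : ℕ} (X : MarkedSurface g) {f : MarkovMap g}

/-- The inverse branch of the `n`-th iterate of `f_X` along `j_n ⋯ j_1 j_0`. -/
noncomputable def inverseBranch (w : f.Dual) (n : ℕ) : Disk ≃ₜ Disk := (X.φ (w.inverseBranch n)).1

lemma inverseBranch_lift (w : f.Dual) (n : ℕ) (z : Disk) :
    X.inverseBranch w n (X.lift z) = X.lift ((w.inverseBranch n).1 z) :=
  (X.equivariant _ _).symm

lemma inverseBranch_add_apply (w : f.Dual) (m n : ℕ) (z : Disk) :
    X.inverseBranch w (m + n) z = X.inverseBranch (w.shift m) n (X.inverseBranch w m z) := by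
  rw [inverseBranch, MarkovMap.Dual.inverseBranch_add, map_mul]
  rfl

lemma inverseBranch_mem_circle_iff (w : f.Dual) (n : ℕ) {z : Disk} :
    X.inverseBranch w n z ∈ circle ↔ z ∈ circle :=
  X.isSurfaceGroup.mem_circle_iff (X.φ _).2

lemma exists_hasPole_inverseBranch (w : f.Dual) (n : ℕ) : ∃ p, HasPole (X.inverseBranch w n) p :=
  (X.isSurfaceGroup.mobius _ (X.φ _).2).exists_hasPole

lemma inverseBranch_mem (w : f.Dual) (n : ℕ) {x : Disk} (hx : x ∈ X.interval (w.1 0)) :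
    X.inverseBranch w n x ∈ X.interval (w.1 n) := by
  obtain ⟨z, hz, rfl⟩ := hx
  rw [inverseBranch_lift]
  exact mem_image_of_mem _ (w.inverseBranch_mem n hz)

lemma interval_subset_circle (I : Interval g) : X.interval I ⊆ circle := by
  rintro _ ⟨z, hz, rfl⟩
  exact (X.lift_mem_circle z).mpr (I.subset_circle hz)

lemma isCompact_interval (I : Interval g) : IsCompact (X.interval I) :=
  I.isClosed.isCompact.image X.lift.continuous

variable (f) in
/-- The marking is uniformly continuous in both directions, so it carries the contraction over
to `X`, without any rate. -/
lemma exists_dist_inverseBranch_le (hg : 2 ≤ g) [Finite (Interval g)] :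
    ∃ δ : ℝ, 0 < δ ∧ δ ≤ 1 ∧ ∀ η : ℝ, 0 < η → ∃ N, ∀ n ≥ N, ∀ w : f.Dual,
      ∀ x ∈ X.interval (w.1 0),
        (∀ y, dist y x ≤ δ → dist (X.inverseBranch w n y) (X.inverseBranch w n x) ≤ η) ∧
        (∀ y ∈ X.interval (w.1 0),
          dist (X.inverseBranch w n y) (X.inverseBranch w n x) ≤ η) := by
  obtain ⟨ε, θ, hε, hθ, hθ1, h⟩ := MarkovMap.Dual.exists_dist_inverseBranch_le (f := f) hg
  have huc := CompactSpace.uniformContinuous_of_continuous X.lift.continuous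
  have huc' := CompactSpace.uniformContinuous_of_continuous X.lift.symm.continuous
  obtain ⟨δ, hδ, hδε⟩ := Metric.uniformContinuous_iff.mp huc' ε hε
  refine ⟨min (δ / 2) 1, by positivity, min_le_right _ _, fun η hη => ?_⟩
  obtain ⟨κ, hκ, hκη⟩ := Metric.uniformContinuous_iff.mp huc η hη
  obtain ⟨N, hN⟩ := exists_pow_lt_of_lt_one (show 0 < κ / 2 by positivity) hθ1
  have hdist : ∀ a b : Disk, dist a b ≤ 2 := by
    intro a b
    have ha := mem_closedBall_zero_iff.mp a.2
    have hb := mem_closedBall_zero_iff.mp b.2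
    have := norm_sub_le (a : ℂ) b
    rw [Subtype.dist_eq, Complex.dist_eq]
    linarith
  have hsmall : ∀ n ≥ N, ∀ a b : Disk, θ ^ n * dist a b < κ := by
    intro n hn a b
    have h1 : θ ^ n ≤ θ ^ N := pow_le_pow_of_le_one hθ.le hθ1.le hn
    calc θ ^ n * dist a b ≤ θ ^ N * 2 := by gcongr; exact hdist a b
      _ < κ := by linarith
  refine ⟨N, fun n hn w => ?_⟩
  rintro _ ⟨x, hx, rfl⟩
  constructor
  · intro y hy
    obtain ⟨y, rfl⟩ := X.lift.surjective y
    have hyx : dist y x ≤ ε := by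
      have := hδε (hy.trans_lt ((min_le_left _ _).trans_lt (by linarith)))
      rw [X.lift.symm_apply_apply, X.lift.symm_apply_apply] at this
      exact this.le
    rw [inverseBranch_lift, inverseBranch_lift]
    exact (hκη (((h w x hx n).1 y hyx).trans_lt (hsmall n hn y x))).le
  · rintro _ ⟨y, hy, rfl⟩
    rw [inverseBranch_lift, inverseBranch_lift]
    exact (hκη (((h w x hx n).2 y hy).trans_lt (hsmall n hn y x))).le

variable (f) in
lemma exists_le_norm_sub_pole (hg : 2 ≤ g) [Finite (Interval g)] :
    ∃ m : ℝ, 0 < m ∧ ∃ N, ∀ n ≥ N, ∀ w : f.Dual, ∀ p, HasPole (X.inverseBranch w n) p →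
      ∀ x ∈ X.interval (w.1 0), m ≤ ‖(x : ℂ) - p‖ := by
  obtain ⟨δ, hδ, hδ1, h⟩ := X.exists_dist_inverseBranch_le f hg
  obtain ⟨N, hN⟩ := h (1 / 8) (by norm_num)
  refine ⟨δ / 2, by positivity, N, fun n hn w p hp x hx => ?_⟩
  exact hp.half_le_norm_sub (X.interval_subset_circle _ hx) hδ1 le_rfl
    fun y _ hy => (hN n hn w x hx).1 y hy

variable (f) in
/-- Möbius maps that map a two-sided neighbourhood of definite size to a small set contract by a
definite factor. Hence the topological contraction on `X` is exponential. -/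
lemma exists_exponential_contraction (hg : 2 ≤ g) [Finite (Interval g)] :
    ∃ C μ : ℝ, 0 < C ∧ 0 < μ ∧ μ < 1 ∧ ∀ (n : ℕ) (w : f.Dual),
      ∀ x ∈ X.interval (w.1 0), ∀ y ∈ X.interval (w.1 0),
        dist (X.inverseBranch w n x) (X.inverseBranch w n y) ≤ C * μ ^ n := by
  obtain ⟨δ, hδ, hδ1, h⟩ := X.exists_dist_inverseBranch_le f hg
  have hδsq : δ ^ 2 ≤ 1 := pow_le_one₀ hδ.le hδ1
  obtain ⟨q', hq'⟩ := h (δ ^ 2 / 32) (by positivity)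
  obtain ⟨q, hq0, hq⟩ : ∃ q, 0 < q ∧ q' ≤ q := ⟨q' + 1, by omega, by omega⟩
  obtain ⟨N, hN⟩ := h (δ / 4) (by positivity)
  -- contraction by the factor `1 / 2` in every `q` steps
  have hstep : ∀ (w : f.Dual), ∀ x ∈ X.interval (w.1 0), ∀ y ∈ circle, dist y x ≤ δ / 4 →
      dist (X.inverseBranch w q y) (X.inverseBranch w q x) ≤ 1 / 2 * dist y x := by
    intro w x hx y hy hyx
    obtain ⟨p, hp⟩ := X.exists_hasPole_inverseBranch w q
    have := hp.dist_le_of_small (X.interval_subset_circle _ hx) hδ hδ1 (by linarith)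
      (fun y _ hy => (hq' q hq w x hx).1 y hy) hy hyx
    rwa [show 16 * (δ ^ 2 / 32) / δ ^ 2 = 1 / 2 by field_simp; norm_num] at this
  have hpow : ∀ (k : ℕ) (w : f.Dual), ∀ x ∈ X.interval (w.1 0), ∀ y ∈ circle, dist y x ≤ δ / 4 →
      dist (X.inverseBranch w (q * k) y) (X.inverseBranch w (q * k) x) ≤
        (1 / 2) ^ k * dist y x := by
    intro k w x hx y hy hyx
    induction k with
    | zero => simp [inverseBranch, MarkovMap.Dual.inverseBranch]
    | succ k ih =>
      rw [mul_add_one, inverseBranch_add_apply, inverseBranch_add_apply]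
      have h1 : (1 / 2 : ℝ) ^ k * dist y x ≤ dist y x :=
        mul_le_of_le_one_left dist_nonneg (pow_le_one₀ (by norm_num) (by norm_num))
      have h2 := hstep (w.shift (q * k)) _ (X.inverseBranch_mem w (q * k) hx) _
        ((X.inverseBranch_mem_circle_iff w (q * k)).mpr hy) (ih.trans (h1.trans hyx))
      refine h2.trans ?_
      rw [pow_succ]
      linarith
  set μ : ℝ := 1 - 1 / (2 * q) with hμ
  have hq1 : (1 : ℝ) ≤ q := by exact_mod_cast hq0
  have hμ0 : 0 < μ := by
    rw [hμ, sub_pos, div_lt_one (by positivity)]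
    linarith
  have hμ1 : μ < 1 := by
    rw [hμ, sub_lt_self_iff]
    positivity
  have hμq : 1 / 2 ≤ μ ^ q := by
    have hB := one_add_mul_le_pow (a := -(1 / (2 * (q : ℝ)))) (by
      rw [neg_le_neg_iff, div_le_iff₀ (by positivity)]
      linarith) q
    rw [hμ, sub_eq_add_neg]
    refine le_trans (le_of_eq ?_) hB
    field_simp
    norm_num
  refine ⟨2 / μ ^ (N + q), μ, by positivity, hμ0, hμ1, fun n w x hx y hy => ?_⟩
  rw [div_mul_eq_mul_div, le_div_iff₀ (by positivity)]
  have hd2 : dist (X.inverseBranch w n x) (X.inverseBranch w n y) ≤ 2 := by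
    have ha := mem_closedBall_zero_iff.mp (X.inverseBranch w n x).2
    have hb := mem_closedBall_zero_iff.mp (X.inverseBranch w n y).2
    have := norm_sub_le (X.inverseBranch w n x : ℂ) (X.inverseBranch w n y)
    rw [Subtype.dist_eq, Complex.dist_eq]
    linarith
  rcases lt_or_ge n N with hn | hn
  · have h1 : μ ^ (N + q) ≤ μ ^ n := pow_le_pow_of_le_one hμ0.le hμ1.le (by omega)
    gcongr
  · -- `n = (N + r) + q k` with `r < q`: the first `N + r` steps bring the interval below `δ / 4`
    obtain ⟨k, r, hr, hn'⟩ : ∃ k r, r < q ∧ n = (N + r) + q * k :=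
      ⟨(n - N) / q, (n - N) % q, Nat.mod_lt _ hq0, by have := Nat.mod_add_div (n - N) q; omega⟩
    have h1 := (hN (N + r) (by omega) w y hy).2 x hx
    have h2 := hpow k (w.shift (N + r)) _ (X.inverseBranch_mem w (N + r) hy) _
      (X.interval_subset_circle _ (X.inverseBranch_mem w (N + r) hx)) h1
    rw [← inverseBranch_add_apply, ← inverseBranch_add_apply, ← hn'] at h2
    have h3 : (1 / 2 : ℝ) ^ k ≤ μ ^ (q * k) := by
      rw [pow_mul]
      gcongr
    have h4 : μ ^ (N + q) ≤ μ ^ (N + r) := pow_le_pow_of_le_one hμ0.le hμ1.le (by omega)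
    calc dist (X.inverseBranch w n x) (X.inverseBranch w n y) * μ ^ (N + q)
        ≤ ((1 / 2) ^ k * (δ / 4)) * μ ^ (N + q) := by
          gcongr
          exact h2.trans (by gcongr)
      _ ≤ (μ ^ (q * k) * 2) * μ ^ (N + r) := by
          gcongr
          linarith
      _ = 2 * μ ^ n := by
          rw [hn', pow_add μ (N + r) (q * k)]
          ring

end MarkedSurface

/-! ### Convergence of the ratios -/

lemma exists_abs_sub_le_of_geometric {u : ℕ → ℝ} {B μ : ℝ} (hμ1 : μ < 1)
    (h : ∀ n, |u (n + 1) - u n| ≤ B * μ ^ n) : ∃ L, ∀ n, |u n - L| ≤ B / (1 - μ) * μ ^ n := by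
  have h' : ∀ n, dist (u n) (u (n + 1)) ≤ B * μ ^ n := fun n => by
    rw [dist_comm, Real.dist_eq]
    exact h n
  obtain ⟨L, hL⟩ := cauchySeq_tendsto_of_complete (cauchySeq_of_le_geometric μ B hμ1 h')
  refine ⟨L, fun n => ?_⟩
  have := dist_le_of_le_geometric_of_tendsto μ B hμ1 h' hL n
  rw [Real.dist_eq] at this
  rwa [div_mul_eq_mul_div]

lemma word_congr {α : Type*} {j j' : ℕ → α} {n : ℕ} (h : ∀ m ≤ n, j m = j' m) :
    word j n = word j' n := by
  induction n with
  | zero => simp [word, h 0 le_rfl]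
  | succ n ih => simp [word, h (n + 1) le_rfl, ih fun m hm => h m (by omega)]

lemma dropLast_word {α : Type*} (j : ℕ → α) (n : ℕ) :
    (word j (n + 1)).dropLast = word (fun m => j (1 + m)) n := by
  induction n with
  | zero => rfl
  | succ n ih =>
    rw [word, List.dropLast_cons_of_ne_nil (by simp [word]), ih, word, Nat.add_comm 1 (n + 1)]

namespace MarkovMap.Dual

variable {g : ℕ} {f : MarkovMap g} (w : f.Dual)

/-- The part of the interval of `j_1` which the Markov map sends to the interval of `j_0`. -/
def preimageInterval : Set Disk := (w.inverseBranch 1).1 '' (w.1 0).1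

lemma preimageInterval_subset : w.preimageInterval ⊆ (w.1 1).1 := by
  rintro _ ⟨x, hx, rfl⟩
  exact w.inverseBranch_mem 1 hx

lemma isClosed_preimageInterval : IsClosed w.preimageInterval :=
  ((w.inverseBranch 1).1.isClosed_image).mpr (w.1 0).isClosed

lemma preimageInterval_eq_iff :
    w.preimageInterval = (w.1 1).1 ↔ gen g (f.side (w.1 1)) '' (w.1 1).1 = (w.1 0).1 := by
  have h : gen g (f.side (w.1 1)) '' w.preimageInterval = (w.1 0).1 := by
    rw [preimageInterval, image_image]
    exact (image_congr fun z _ => w.gen_inverseBranch_succ 0 z).trans (image_id _)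
  constructor
  · intro h'
    rw [← h', h]
  · intro h'
    exact (gen g (f.side (w.1 1))).injective.image_injective (h.trans h'.symm)

end MarkovMap.Dual

namespace MarkedSurface

variable {g : ℕ} (X : MarkedSurface g) {f : MarkovMap g}

lemma inverseBranch_succ_image (w : f.Dual) (n : ℕ) (A : Set Disk) :
    X.inverseBranch w (n + 1) '' A =
      X.branch f (w.1 (n + 1)) ⁻¹' (X.inverseBranch w n '' A) := by
  have h : X.inverseBranch w (n + 1) =
      (X.branch f (w.1 (n + 1)))⁻¹ * X.inverseBranch w n := by
    rw [inverseBranch, MarkovMap.Dual.inverseBranch, map_mul, map_inv]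
    rfl
  rw [h]
  rw [← Homeomorph.image_symm, image_image]
  rfl

lemma cylinder_word (w : f.Dual) (n : ℕ) :
    X.cylinder f (word w.1 n) = X.inverseBranch w n '' X.interval (w.1 0) := by
  induction n with
  | zero =>
    have h0 : (X.inverseBranch w 0 : Disk → Disk) = id := by
      simp [inverseBranch, MarkovMap.Dual.inverseBranch]
      rfl
    rw [h0, image_id, word, cylinder, cylinder, inter_eq_left]
    intro z hz
    exact (X.isSurfaceGroup.mem_circle_iff (X.φ _).2).mpr (X.interval_subset_circle _ hz)
  | succ n ih =>
    rw [word, cylinder, ih, ← inverseBranch_succ_image, inter_eq_right]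
    rintro _ ⟨z, hz, rfl⟩
    exact X.inverseBranch_mem w (n + 1) hz

/-- The interval of a word and of its image under `σ^*` are the images of two fixed nested sets
under the same Möbius map. -/
lemma preScaling_word_succ (w : f.Dual) (n : ℕ) :
    X.preScaling f (word w.1 (n + 1)) =
      arcLength (X.inverseBranch (w.shift 1) n '' (X.lift '' w.preimageInterval)) /
        arcLength (X.inverseBranch (w.shift 1) n '' X.interval (w.1 1)) := by
  have h1 : X.inverseBranch w (n + 1) '' X.interval (w.1 0) =
      X.inverseBranch (w.shift 1) n '' (X.lift '' w.preimageInterval) := by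
    rw [MarkovMap.Dual.preimageInterval, interval, image_image, image_image, image_image,
      Nat.add_comm]
    exact image_congr fun z _ => by rw [inverseBranch_add_apply, inverseBranch_lift]
  rw [preScaling, cylinder_word, dropLast_word, h1]
  congr 2
  exact X.cylinder_word (w.shift 1) n

lemma arcLength_lift_image_pos {A U : Set Disk} (hA : IsClosed A) (hU : IsOpen U) {B : Set Disk}
    (hB : IsClosed B) (hAc : A ⊆ circle) (hUA : circle ∩ U ⊆ A \ B) (hne : (circle ∩ U).Nonempty) :
    0 < arcLength (X.lift '' A \ X.lift '' B) := by
  have hcirc : X.lift '' A ⊆ circle := by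
    rintro _ ⟨z, hz, rfl⟩
    exact (X.lift_mem_circle z).mpr (hAc hz)
  refine arcLength_pos ?_ (sdiff_subset.trans hcirc) (U := X.lift '' U)
    (X.lift.isOpen_image.mpr hU) ?_ ?_
  · exact (X.lift.isClosed_image.mpr hA).measurableSet.diff
      (X.lift.isClosed_image.mpr hB).measurableSet
  · rintro _ ⟨hz, z, hzU, rfl⟩
    have h := hUA ⟨(X.lift_mem_circle z).mp hz, hzU⟩
    rw [← image_sdiff X.lift.injective]
    exact mem_image_of_mem _ h
  · obtain ⟨z, hz, hzU⟩ := hne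
    exact ⟨X.lift z, (X.lift_mem_circle z).mpr hz, mem_image_of_mem _ hzU⟩

lemma arcLength_interval_pos (hW : (cutSet g).Finite) (I : Interval g) :
    0 < arcLength (X.interval I) := by
  obtain ⟨U, hU, hne, hI⟩ := I.exists_isOpen_closure_eq hW
  have h := X.arcLength_lift_image_pos I.isClosed hU isClosed_empty I.subset_circle
    (by rw [sdiff_empty, hI]; exact subset_closure) hne
  rwa [image_empty, sdiff_empty] at h

/-- A closed proper subset of an interval leaves out a set of positive length. -/
lemma arcLength_interval_sdiff_pos (hW : (cutSet g).Finite) (I : Interval g) {K : Set Disk}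
    (hK : IsClosed K) (hKI : K ⊆ I.1) (hne : K ≠ I.1) :
    0 < arcLength (X.interval I \ X.lift '' K) := by
  obtain ⟨U, hU, -, hI⟩ := I.exists_isOpen_closure_eq hW
  refine X.arcLength_lift_image_pos I.isClosed (hU.inter hK.isOpen_compl) hK I.subset_circle ?_ ?_
  · rintro z ⟨hz, hzU, hzK⟩
    exact ⟨hI ▸ subset_closure ⟨hz, hzU⟩, hzK⟩
  · by_contra hempty
    rw [not_nonempty_iff_eq_empty] at hempty
    refine hne (hKI.antisymm ?_)
    rw [hI]
    refine closure_minimal (fun z hz => ?_) hK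
    by_contra hzK
    exact (hempty ▸ ⟨hz.1, hz.2, hzK⟩ : z ∈ (∅ : Set Disk))

variable (f) in
/-- The length ratios of nested sets change exponentially little under further inverse
branches. -/
lemma exists_abs_ratio_sub_le (hg : 2 ≤ g) [Finite (Interval g)] (hW : (cutSet g).Finite) :
    ∃ B μ : ℝ, 0 < B ∧ 0 < μ ∧ μ < 1 ∧ ∀ (w : f.Dual) (K : Set Disk), MeasurableSet K →
      K ⊆ X.interval (w.1 0) → ∀ n,
        |arcLength (X.inverseBranch w (n + 1) '' K) /
            arcLength (X.inverseBranch w (n + 1) '' X.interval (w.1 0)) -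
          arcLength (X.inverseBranch w n '' K) /
            arcLength (X.inverseBranch w n '' X.interval (w.1 0))| ≤ B * μ ^ n := by
  obtain ⟨C, μ, hC, hμ0, hμ1, hcontr⟩ := X.exists_exponential_contraction f hg
  have hbranch : ∀ s : Fin (4 * g), ∃ p, HasPole (X.φ (gen₀ g s)⁻¹).1 p := fun s =>
    (X.isSurfaceGroup.mobius _ (X.φ _).2).exists_hasPole
  choose p hp using hbranch
  obtain ⟨ρ, hρ1, hρ⟩ : ∃ ρ < 1, ∀ s, ‖p s‖ ≤ ρ := by
    have : Nonempty (Fin (4 * g)) := ⟨⟨0, by omega⟩⟩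
    obtain ⟨s, hs⟩ := Finite.exists_max fun s => ‖p s‖
    exact ⟨_, (hp s).norm_lt, hs⟩
  have h1ρ : 0 < 1 - ρ := by linarith
  refine ⟨4 / (1 - ρ) ^ 2 * C, μ, by positivity, hμ0, hμ1, fun w K hK hKI n => ?_⟩
  set s := f.side (w.1 (n + 1)) with hs
  have hsucc : ∀ A : Set Disk, X.inverseBranch w (n + 1) '' A =
      (X.φ (gen₀ g s)⁻¹).1 '' (X.inverseBranch w n '' A) := by
    intro A
    rw [inverseBranch, MarkovMap.Dual.inverseBranch, map_mul, image_image]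
    rfl
  have hcircle : X.inverseBranch w n '' X.interval (w.1 0) ⊆ circle := by
    rintro _ ⟨z, hz, rfl⟩
    exact (X.inverseBranch_mem_circle_iff w n).mpr (X.interval_subset_circle _ hz)
  obtain ⟨q, hq⟩ := X.exists_hasPole_inverseBranch w n
  rw [hsucc, hsucc, mul_assoc]
  refine (hp s).abs_ratio_image_sub_le
    (fun z hz => (X.isSurfaceGroup.mem_circle_iff (X.φ _).2).mpr hz)
    ((X.isCompact_interval _).image (X.inverseBranch w n).continuous) hcircle
    ((X.inverseBranch w n).measurableEmbedding.measurableSet_image.mpr hK) (image_mono hKI)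
    ?_ ?_ hρ1 (hρ s)
  · exact hq.arcLength_image_pos (fun z hz => (X.inverseBranch_mem_circle_iff w n).mpr hz)
      (X.isCompact_interval _).measurableSet (X.interval_subset_circle _)
      (X.arcLength_interval_pos hW _)
  · rintro _ ⟨x, hx, rfl⟩ _ ⟨y, hy, rfl⟩
    exact hcontr n w x hx y hy

/-- Length ratios stay bounded away from `0` under the inverse branches, since the poles of these
stay away from the interval. -/
lemma exists_le_ratio (hg : 2 ≤ g) [Finite (Interval g)] (hW : (cutSet g).Finite) (w : f.Dual)
    {K : Set Disk} (hK : MeasurableSet K) (hKI : K ⊆ X.interval (w.1 0)) (hpos : 0 < arcLength K) :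
    ∃ c > 0, ∃ N, ∀ n ≥ N, c ≤ arcLength (X.inverseBranch w n '' K) /
      arcLength (X.inverseBranch w n '' X.interval (w.1 0)) := by
  obtain ⟨m, hm, N, hN⟩ := X.exists_le_norm_sub_pole f hg
  have hIpos := X.arcLength_interval_pos hW (w.1 0)
  refine ⟨(m / 2) ^ 2 * (arcLength K / arcLength (X.interval (w.1 0))), by positivity, N,
    fun n hn => ?_⟩
  obtain ⟨q, hq⟩ := X.exists_hasPole_inverseBranch w n
  exact hq.le_ratio_image (fun z hz => (X.inverseBranch_mem_circle_iff w n).mpr hz)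
    (X.isCompact_interval _).measurableSet (X.interval_subset_circle _) hK hKI hIpos hm two_pos
    (hN n hn w q hq) fun z hz => hq.norm_sub_le (X.interval_subset_circle _ hz)

end MarkedSurface

end ScalingFunction

open ScalingFunction
theorem mainTheorem6 (g : ℕ) (hg : 2 ≤ g) (f : MarkovMap g) (X : MarkedSurface g) :
    ∃ S : f.Dual → ℝ,
      TendstoUniformly (fun (n : ℕ) (w : f.Dual) => X.preScaling f (word w.1 n)) S atTop ∧
      (∀ w : f.Dual, 0 < S w ∧ S w ≤ 1) ∧
      (∀ w : f.Dual, S w = 1 ↔ gen g (f.side (w.1 1)) '' (w.1 1).1 = (w.1 0).1) ∧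
      f.IsLipschitz S := by
  have hW := X.finite_cutSet hg
  have : Finite (Interval g) := finite_interval hW
  obtain ⟨B, μ, hB, hμ0, hμ1, hratio⟩ := X.exists_abs_ratio_sub_le f hg hW
  -- `K w ⊆ X.interval (w.1 1)` are the nested sets whose images have the pre-scaling ratios
  set K : f.Dual → Set Disk := fun w => X.lift '' w.preimageInterval with hK
  have hKc : ∀ w, IsClosed (K w) := fun w =>
    X.lift.isClosed_image.mpr w.isClosed_preimageInterval
  have hKI : ∀ w, K w ⊆ X.interval (w.1 1) := fun w => image_mono w.preimageInterval_subset
  have hImeas : ∀ w : f.Dual, MeasurableSet (X.interval (w.1 1)) := fun w =>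
    (X.isCompact_interval _).measurableSet
  have hmeas : ∀ (w : f.Dual) (n : ℕ) {A : Set Disk}, MeasurableSet A →
      MeasurableSet (X.inverseBranch (w.shift 1) n '' A) := fun w n A hA =>
    (X.inverseBranch (w.shift 1) n).measurableEmbedding.measurableSet_image.mpr hA
  have hIc : ∀ (w : f.Dual) (n : ℕ),
      X.inverseBranch (w.shift 1) n '' X.interval (w.1 1) ⊆ circle := by
    rintro w n _ ⟨z, hz, rfl⟩
    exact (X.inverseBranch_mem_circle_iff _ n).mpr (X.interval_subset_circle _ hz)
  have hIpos : ∀ (w : f.Dual) (n : ℕ),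
      0 < arcLength (X.inverseBranch (w.shift 1) n '' X.interval (w.1 1)) := by
    intro w n
    obtain ⟨q, hq⟩ := X.exists_hasPole_inverseBranch (w.shift 1) n
    exact hq.arcLength_image_pos (fun z hz => (X.inverseBranch_mem_circle_iff _ n).mpr hz)
      (hImeas w) (X.interval_subset_circle _) (X.arcLength_interval_pos hW _)
  have hlim : ∀ w : f.Dual, ∃ L, ∀ n,
      |X.preScaling f (word w.1 (n + 1)) - L| ≤ B / (1 - μ) * μ ^ n := by
    intro w
    refine exists_abs_sub_le_of_geometric hμ1 fun n => ?_
    rw [X.preScaling_word_succ w (n + 1), X.preScaling_word_succ w n]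
    exact hratio (w.shift 1) (K w) (hKc w).measurableSet (hKI w) n
  choose S hS using hlim
  set D := B / (1 - μ) with hD
  have hD0 : 0 < D := div_pos hB (by linarith)
  have hgeom : Tendsto (fun n : ℕ => D * μ ^ n) atTop (nhds 0) := by
    simpa using (tendsto_pow_atTop_nhds_zero_of_lt_one hμ0.le hμ1).const_mul D
  have htend : ∀ w, Tendsto (fun n => X.preScaling f (word w.1 (n + 1))) atTop (nhds (S w)) :=
    fun w => tendsto_iff_dist_tendsto_zero.mpr
      (squeeze_zero (fun _ => dist_nonneg) (fun n => by rw [Real.dist_eq]; exact hS w n) hgeom)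
  have hpos : ∀ w, 0 < S w := by
    intro w
    have hKpos : 0 < arcLength (K w) := by
      obtain ⟨q, hq⟩ := X.exists_hasPole_inverseBranch w 1
      have himage : X.inverseBranch w 1 '' X.interval (w.1 0) = K w := by
        change _ = X.lift '' w.preimageInterval
        rw [MarkovMap.Dual.preimageInterval, MarkedSurface.interval, image_image, image_image]
        exact image_congr fun z _ => X.inverseBranch_lift w 1 z
      rw [← himage]
      exact hq.arcLength_image_pos (fun z hz => (X.inverseBranch_mem_circle_iff w 1).mpr hz)
        (X.isCompact_interval _).measurableSet (X.interval_subset_circle _)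
        (X.arcLength_interval_pos hW _)
    obtain ⟨c, hc, N, hN⟩ := X.exists_le_ratio hg hW (w.shift 1) (hKc w).measurableSet (hKI w) hKpos
    refine hc.trans_le (ge_of_tendsto (htend w) ?_)
    filter_upwards [eventually_ge_atTop N] with n hn
    rw [X.preScaling_word_succ]
    exact hN n hn
  have hle : ∀ w, S w ≤ 1 := by
    intro w
    refine le_of_tendsto' (htend w) fun n => ?_
    rw [X.preScaling_word_succ, div_le_one (hIpos w n)]
    exact arcLength_mono (hmeas w n (hImeas w)) (hmeas w n (hKc w).measurableSet)
      (image_mono (hKI w)) (hIc w n)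
  refine ⟨S, ?_, fun w => ⟨hpos w, hle w⟩, fun w => ?_, ?_⟩
  · rw [Metric.tendstoUniformly_iff]
    intro ε hε
    obtain ⟨N, hN⟩ := eventually_atTop.mp (hgeom.eventually_lt_const hε)
    filter_upwards [eventually_ge_atTop (N + 1)] with n hn w
    obtain ⟨k, rfl⟩ : ∃ k, n = k + 1 := ⟨n - 1, by omega⟩
    rw [dist_comm, Real.dist_eq]
    exact (hS w k).trans_lt (hN k (by omega))
  · rw [← w.preimageInterval_eq_iff]
    constructor
    · intro h1
      by_contra hne
      -- the complement of `K w` in the interval keeps a definite proportion of the length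
      have hcpos := X.arcLength_interval_sdiff_pos hW (w.1 1) w.isClosed_preimageInterval
        w.preimageInterval_subset hne
      obtain ⟨c, hc, N, hN⟩ := X.exists_le_ratio hg hW (w.shift 1)
        ((hImeas w).diff (hKc w).measurableSet) sdiff_subset hcpos
      have hlt : S w ≤ 1 - c := by
        refine le_of_tendsto (htend w) ?_
        filter_upwards [eventually_ge_atTop N] with n hn
        have h2 := hN n hn
        rw [image_sdiff (X.inverseBranch (w.shift 1) n).injective,
          arcLength_diff (hmeas w n (hImeas w)) (hmeas w n (hKc w).measurableSet)
            (image_mono (hKI w)) (hIc w n), sub_div] at h2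
        have h3 := div_self (hIpos w n).ne'
        rw [X.preScaling_word_succ]
        change c ≤ arcLength (X.inverseBranch (w.shift 1) n '' X.interval (w.1 1)) /
          arcLength (X.inverseBranch (w.shift 1) n '' X.interval (w.1 1)) -
          arcLength (X.inverseBranch (w.shift 1) n '' (X.lift '' w.preimageInterval)) /
          arcLength (X.inverseBranch (w.shift 1) n '' X.interval (w.1 1)) at h2
        linarith
      linarith
    · intro h
      refine tendsto_nhds_unique (htend w) (tendsto_const_nhds.congr fun n => ?_)
      rw [X.preScaling_word_succ, h]
      exact (div_self (hIpos w n).ne').symm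
  · refine ⟨(2 * D + 1) / μ ^ 2, μ, by positivity, hμ0, hμ1, fun w w' n hn => ?_⟩
    rw [div_mul_eq_mul_div, le_div_iff₀ (by positivity)]
    rcases lt_or_ge n 2 with h2 | h2
    · have h3 : |S w - S w'| ≤ 1 := by
        rw [abs_le]
        constructor <;> linarith [hpos w, hpos w', hle w, hle w']
      have h4 : μ ^ 2 ≤ μ ^ n := pow_le_pow_of_le_one hμ0.le hμ1.le (by omega)
      have h5 : 0 < μ ^ n := by positivity
      nlinarith [abs_nonneg (S w - S w')]
    · -- the ratio of the words with `n` digits is the same for `w` and `w'`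
      obtain ⟨k, rfl⟩ : ∃ k, n = k + 2 := ⟨n - 2, by omega⟩
      have hword : word w.1 (k + 1) = word w'.1 (k + 1) :=
        word_congr fun m hm => hn m (by omega)
      have h3 := hS w k
      have h4 := hS w' k
      rw [hword] at h3
      have h5 : |S w - S w'| ≤ 2 * D * μ ^ k := by
        rw [abs_le] at h3 h4 ⊢
        constructor <;> linarith
      have h6 : 0 < μ ^ k := by positivity
      calc |S w - S w'| * μ ^ 2 ≤ (2 * D * μ ^ k) * μ ^ 2 := by gcongr
        _ ≤ (2 * D + 1) * μ ^ (k + 2) := by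
          rw [pow_add]
          nlinarith [mul_pos h6 (pow_pos hμ0 2)]
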